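/- Let $a<0<b$ and let $C[a,b]$ be the space of real continuous functions on $[a,b]$ with the supremum norm. Let $c:\mathbb R\to[0,\infty)$ be continuous with $\gamma:=\int_{-\infty}^{\infty}c(x)\,dx<\infty$, put $c_\varepsilon(x)=\varepsilon^{-1}c(\varepsilon^{-1}x)$, and assume that $\lim_{\varepsilon\to0+}c_\varepsilon(x)=0$ for every $x\neq0$. For $\varepsilon\in(0,1]$ let $A_\varepsilon f=\tfrac12f''-c_\varepsilon f$ with domain consisting of all $f\in C^2[a,b]$ (one-sided derivatives at the ends) such that $f''(a)=f''(b)=0$. Let $A f=\tfrac12 f''$ with domain consisting of all $f\in C[a,b]$ that are twice continuously differentiable on $[a,0]$ and on $[0,b]$ separately (one-sided derivatives at the ends) and satisfy $$f''(a)=f''(b)=0,\qquad f''(0+)=f''(0-),\qquad f'(0+)-f'(0-)=2\gamma f(0).$$ A Feller generator is the infinitesimal generator of a strongly continuous semigroup of positive contractions on $C[a,b]$. Then $A$ and all $A_\varepsilon$, $\varepsilon\in(0,1]$, are Feller generators, and for every $f\in C[a,b]$ $$\lim_{\varepsilon\to0+}e^{tA_\varepsilon}f=e^{tA}f\quad\text{in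 }C[a,b],\qquad t\ge0,$$ uniformly for $t$ in bounded intervals. -/

import Mathlib

open Set Filter Topology
open scoped NNReal

noncomputable section

/-- A Feller semigroup on `C(K)`, `K` compact: a strongly continuous semigroup of positive
contractions. (It need not preserve the constant function `1`, that is, killing is allowed.) -/
structure IsFellerSemigroup {K : Type*} [TopologicalSpace K] [CompactSpace K]
    (T : ℝ≥0 → C(K, ℝ) →L[ℝ] C(K, ℝ)) : Prop where
  zero : ∀ f, T 0 f = f
  add : ∀ s t f, T (s + t) f = T s (T t f)
  contraction : ∀ t f, ‖T t f‖ ≤ ‖f‖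
  nonneg : ∀ t f, 0 ≤ f → 0 ≤ T t f
  continuous : ∀ f, Continuous fun t => T t f

/-- `A` (with its domain) is the infinitesimal generator of the family `T`: `f` is in the domain of
`A` and `A f = g` if and only if `(T t f - f) / t → g` in norm as `t → 0+`. -/
def IsGeneratorOf {E : Type*} [NormedAddCommGroup E] [NormedSpace ℝ E]
    (A : E →ₗ.[ℝ] E) (T : ℝ≥0 → E →L[ℝ] E) : Prop :=
  ∀ f g : E, (∃ hf : f ∈ A.domain, A ⟨f, hf⟩ = g) ↔
    Tendsto (fun t : ℝ≥0 => (t : ℝ)⁻¹ • (T t f - f)) (𝓝[>] 0) (𝓝 g)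

/-- `A` is a Feller generator: it is the generator of a Feller semigroup. -/
def IsFellerGenerator {K : Type*} [TopologicalSpace K] [CompactSpace K]
    (A : C(K, ℝ) →ₗ.[ℝ] C(K, ℝ)) : Prop :=
  ∃ T : ℝ≥0 → C(K, ℝ) →L[ℝ] C(K, ℝ), IsFellerSemigroup T ∧ IsGeneratorOf A T

/-- A function on `[a, b]` seen as a function on the line (only its values and its one-sided
derivatives within subintervals of `[a, b]` are ever used). -/
def onLine {a b : ℝ} (h : a ≤ b) (f : C(Icc a b, ℝ)) : ℝ → ℝ := IccExtend h f

/-- The derivative of `F` on the interval `[p, q]` (one-sided at the ends). -/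
def d1 (p q : ℝ) (F : ℝ → ℝ) : ℝ → ℝ := derivWithin F (Icc p q)

/-- The second derivative of `F` on the interval `[p, q]` (one-sided at the ends). -/
def d2 (p q : ℝ) (F : ℝ → ℝ) : ℝ → ℝ := iteratedDerivWithin 2 F (Icc p q)

theorem d1_add {p q : ℝ} {F G : ℝ → ℝ} (hF : ContDiffOn ℝ 2 F (Icc p q))
    (hG : ContDiffOn ℝ 2 G (Icc p q)) {x : ℝ} (hx : x ∈ Icc p q) :
    d1 p q (F + G) x = d1 p q F x + d1 p q G x :=
  derivWithin_add (hF.differentiableOn (by norm_num) x hx)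
    (hG.differentiableOn (by norm_num) x hx)

theorem d1_smul {p q : ℝ} (r : ℝ) (F : ℝ → ℝ) (x : ℝ) : d1 p q (r • F) x = r * d1 p q F x := by
  simp [d1, derivWithin_const_smul_field]

theorem d2_add {p q : ℝ} (h : p < q) {F G : ℝ → ℝ} (hF : ContDiffOn ℝ 2 F (Icc p q))
    (hG : ContDiffOn ℝ 2 G (Icc p q)) {x : ℝ} (hx : x ∈ Icc p q) :
    d2 p q (F + G) x = d2 p q F x + d2 p q G x :=
  iteratedDerivWithin_add hx (uniqueDiffOn_Icc h) (hF x hx) (hG x hx)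

theorem d2_smul {p q : ℝ} (r : ℝ) (F : ℝ → ℝ) (x : ℝ) : d2 p q (r • F) x = r * d2 p q F x := by
  simp [d2, iteratedDerivWithin_const_smul_field]

theorem d1_zero (p q x : ℝ) : d1 p q 0 x = 0 := by
  simpa using d1_smul (p := p) (q := q) 0 0 x

theorem d2_zero (p q x : ℝ) : d2 p q 0 x = 0 := by
  simpa using d2_smul (p := p) (q := q) 0 0 x

theorem d2_continuousOn {p q : ℝ} (h : p < q) {F : ℝ → ℝ} (hF : ContDiffOn ℝ 2 F (Icc p q)) :
    ContinuousOn (d2 p q F) (Icc p q) :=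
  hF.continuousOn_iteratedDerivWithin (by norm_num) (uniqueDiffOn_Icc h)

/-- The operator `A₀ f = f'' / 2` with domain
`{f ∈ C²[a, b] : f''(a) = f''(b) = 0}` (Brownian motion on `[a, b]` stopped at the ends). -/
def stoppedBM {a b : ℝ} (h : a < b) : C(Icc a b, ℝ) →ₗ.[ℝ] C(Icc a b, ℝ) where
  domain :=
    { carrier := {f | ContDiffOn ℝ 2 (onLine h.le f) (Icc a b) ∧
        d2 a b (onLine h.le f) a = 0 ∧ d2 a b (onLine h.le f) b = 0}
      zero_mem' := by
        change ContDiffOn ℝ 2 (0 : ℝ → ℝ) (Icc a b) ∧ d2 a b 0 a = 0 ∧ d2 a b 0 b = 0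
        exact ⟨contDiffOn_const, d2_zero _ _ _, d2_zero _ _ _⟩
      add_mem' := by
        rintro f g ⟨hf, hf1, hf2⟩ ⟨hg, hg1, hg2⟩
        change ContDiffOn ℝ 2 (onLine h.le f + onLine h.le g) (Icc a b) ∧
          d2 a b (onLine h.le f + onLine h.le g) a = 0 ∧
          d2 a b (onLine h.le f + onLine h.le g) b = 0
        refine ⟨hf.add hg, ?_, ?_⟩
        · rw [d2_add h hf hg (left_mem_Icc.2 h.le), hf1, hg1, add_zero]
        · rw [d2_add h hf hg (right_mem_Icc.2 h.le), hf2, hg2, add_zero]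
      smul_mem' := by
        rintro r f ⟨hf, hf1, hf2⟩
        change ContDiffOn ℝ 2 (r • onLine h.le f) (Icc a b) ∧
          d2 a b (r • onLine h.le f) a = 0 ∧ d2 a b (r • onLine h.le f) b = 0
        exact ⟨contDiffOn_const.smul hf, by rw [d2_smul, hf1, mul_zero],
          by rw [d2_smul, hf2, mul_zero]⟩ }
  toFun :=
    { toFun := fun f =>
        ⟨fun x => (1 / 2) * d2 a b (onLine h.le f.1) x,
          continuous_const.mul
            (continuousOn_iff_continuous_domRestrict.1 (d2_continuousOn h f.2.1))⟩
      map_add' := by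
        intro f g
        ext x
        change (1 / 2) * d2 a b (onLine h.le f.1 + onLine h.le g.1) x =
          (1 / 2) * d2 a b (onLine h.le f.1) x + (1 / 2) * d2 a b (onLine h.le g.1) x
        rw [d2_add h f.2.1 g.2.1 x.2, mul_add]
      map_smul' := by
        intro r f
        ext x
        change (1 / 2) * d2 a b (r • onLine h.le f.1) x =
          r * ((1 / 2) * d2 a b (onLine h.le f.1) x)
        rw [d2_smul]
        ring }

/-- The rescaled killing rate `c_ε(x) = ε⁻¹ c(ε⁻¹ x)`. -/
def scaledRate (c : C(ℝ, ℝ)) (ε : ℝ) : C(ℝ, ℝ) :=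
  ⟨fun x => ε⁻¹ * c (ε⁻¹ * x), by fun_prop⟩

/-- The operator `A_q f = f'' / 2 - q f` on the domain of `A₀` (killing with rate `q`). -/
def killedBM {a b : ℝ} (h : a < b) (q : C(ℝ, ℝ)) : C(Icc a b, ℝ) →ₗ.[ℝ] C(Icc a b, ℝ) where
  domain := (stoppedBM h).domain
  toFun := (stoppedBM h).toFun -
    (LinearMap.mulLeft ℝ (q.restrict (Icc a b))).comp (stoppedBM h).domain.subtype

/-- The operator `A f = f'' / 2` whose domain consists of those `f ∈ C[a, b]` that are `C²` on
`[a, 0]` and on `[0, b]` separately and satisfy `f''(a) = f''(b) = 0`, `f''(0+) = f''(0-)` and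
`f'(0+) - f'(0-) = κ f(0)`. -/
def elasticBM {a b : ℝ} (ha : a < 0) (hb : 0 < b) (κ : ℝ) :
    C(Icc a b, ℝ) →ₗ.[ℝ] C(Icc a b, ℝ) where
  domain :=
    { carrier := {f |
        ContDiffOn ℝ 2 (onLine (ha.trans hb).le f) (Icc a 0) ∧
        ContDiffOn ℝ 2 (onLine (ha.trans hb).le f) (Icc 0 b) ∧
        d2 a 0 (onLine (ha.trans hb).le f) a = 0 ∧
        d2 0 b (onLine (ha.trans hb).le f) b = 0 ∧
        d2 0 b (onLine (ha.trans hb).le f) 0 = d2 a 0 (onLine (ha.trans hb).le f) 0 ∧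
        d1 0 b (onLine (ha.trans hb).le f) 0 - d1 a 0 (onLine (ha.trans hb).le f) 0
          = κ * onLine (ha.trans hb).le f 0}
      zero_mem' := by
        change ContDiffOn ℝ 2 (0 : ℝ → ℝ) (Icc a 0) ∧ ContDiffOn ℝ 2 (0 : ℝ → ℝ) (Icc 0 b) ∧
          d2 a 0 0 a = 0 ∧ d2 0 b 0 b = 0 ∧ d2 0 b 0 0 = d2 a 0 0 0 ∧
          d1 0 b 0 0 - d1 a 0 0 0 = κ * 0
        simp only [d2_zero, d1_zero, sub_zero, mul_zero, and_true]
        exact ⟨contDiffOn_const, contDiffOn_const⟩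
      add_mem' := by
        rintro f g ⟨hf, hf', h1, h2, h3, h4⟩ ⟨hg, hg', k1, k2, k3, k4⟩
        have e : onLine (ha.trans hb).le (f + g) =
          onLine (ha.trans hb).le f + onLine (ha.trans hb).le g := rfl
        have ma := left_mem_Icc.2 ha.le
        have m0 := right_mem_Icc.2 ha.le
        have m0' := left_mem_Icc.2 hb.le
        have mb := right_mem_Icc.2 hb.le
        refine ⟨e ▸ hf.add hg, e ▸ hf'.add hg', ?_, ?_, ?_, ?_⟩
        · rw [e, d2_add ha hf hg ma, h1, k1, add_zero]
        · rw [e, d2_add hb hf' hg' mb, h2, k2, add_zero]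
        · rw [e, d2_add hb hf' hg' m0', d2_add ha hf hg m0, h3, k3]
        · rw [e, d1_add hf' hg' m0', d1_add hf hg m0, Pi.add_apply, mul_add,
            ← h4, ← k4]
          ring
      smul_mem' := by
        rintro r f ⟨hf, hf', h1, h2, h3, h4⟩
        have e : onLine (ha.trans hb).le (r • f) = r • onLine (ha.trans hb).le f := rfl
        refine ⟨e ▸ contDiffOn_const.smul hf, e ▸ contDiffOn_const.smul hf', ?_, ?_, ?_, ?_⟩
        · rw [e, d2_smul, h1, mul_zero]
        · rw [e, d2_smul, h2, mul_zero]
        · rw [e, d2_smul, d2_smul, h3]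
        · rw [e, d1_smul, d1_smul, Pi.smul_apply, smul_eq_mul, mul_left_comm, ← h4,
            mul_sub] }
  toFun :=
    { toFun := fun f =>
        ⟨fun x => (1 / 2) * if (x : ℝ) ≤ 0 then d2 a 0 (onLine (ha.trans hb).le f.1) x
            else d2 0 b (onLine (ha.trans hb).le f.1) x, by
          refine continuous_const.mul (continuous_if_le continuous_subtype_val continuous_const
            ?_ ?_ ?_)
          · exact (d2_continuousOn ha f.2.1).comp continuous_subtype_val.continuousOn
              fun x hx => ⟨x.2.1, hx⟩
          · exact (d2_continuousOn hb f.2.2.1).comp continuous_subtype_val.continuousOn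
              fun x hx => ⟨hx, x.2.2⟩
          · intro x hx
            rw [hx]
            exact f.2.2.2.2.2.1.symm⟩
      map_add' := by
        intro f g
        ext x
        have e : onLine (ha.trans hb).le (f.1 + g.1) =
          onLine (ha.trans hb).le f.1 + onLine (ha.trans hb).le g.1 := rfl
        simp only [Submodule.coe_add, ContinuousMap.coe_mk, ContinuousMap.add_apply, e]
        split_ifs with hx
        · rw [d2_add ha f.2.1 g.2.1 ⟨x.2.1, hx⟩, mul_add]
        · rw [d2_add hb f.2.2.1 g.2.2.1 ⟨(not_le.1 hx).le, x.2.2⟩, mul_add]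
      map_smul' := by
        intro r f
        ext x
        have e : onLine (ha.trans hb).le (r • f.1) = r • onLine (ha.trans hb).le f.1 := rfl
        simp only [Submodule.coe_smul, ContinuousMap.coe_mk, ContinuousMap.smul_apply, e, d2_smul,
          RingHom.id_apply, smul_eq_mul]
        split_ifs <;> ring }

end

/-! All the generators obey the nonpositive minimum principle, which makes them dissipative with
positive resolvents. For the elastic operator the minimum may sit at the kink: there the one-sided
derivatives have opposite signs while the jump condition makes their difference nonpositive, so both
vanish and the second derivative test still applies. The equation `l f - A f = g` is solved
explicitly with `cosh` and `sinh` for the elastic operator and, at `κ = 0`, for the stopped one;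
killing by a continuous rate is a bounded perturbation handled by a Neumann series. The domains are
dense by Stone–Weierstrass. The Hille–Yosida theorem (`IsMDissipative.exists_semigroup`) then
produces contraction semigroups that preserve the cone of nonnegative functions.

For the convergence, the Trotter–Kato theorem (`tendstoUniformlyOn_semigroup`) asks, for each `f` in
the domain of `A`, for `f_ε` in the domain of `A_ε` with `f_ε → f` and `A_ε f_ε → A f`. Such an `f`
is `α + p x + ∬ k` on the left of `0`, with `k = 2 A f`, and has the extra term `2 γ α x` on the
right. The kink comes from `2 α ∬ c_ε`, which converges uniformly to a piecewise linear function
whose slope jumps by `2 γ α` at `0`; so the natural candidate is `F₁ = α + s x + ∬ (k + 2 α c_ε)`.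

This misses the target by `-c_ε (F₁ - α)`. Since `F₁ - α = O(|x|)` and `|x| c_ε(x)` is uniformly
bounded, the error is bounded but need not be small in supremum norm. It is small in `L¹`, by
dominated convergence. One more iteration, adding `∬ h` with `h = 2 c_ε (F₁ - α) + ℓ`, therefore
suffices: `|∬ h| ≤ ρ |x|` with `ρ → 0`, and the new error is at most `C ρ` plus a boundary term. The
affine function `ℓ`, small because `c_ε(a)` and `c_ε(b)` tend to `0`, restores `f'' = 0` at the
ends. The estimate is `exists_mem_killedBM_close`; its inputs are `exists_abs_mul_le`,
`tendsto_integral_abs_mul_scaledRate` and `exists_prim_prim_scaledRate_bound`. -/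

/-! ### Exponentials of bounded operators. -/

section BoundedOperators

variable {E : Type*} [NormedAddCommGroup E] [NormedSpace ℝ E] [CompleteSpace E]

theorem exp_add_smul (U : E →L[ℝ] E) (s t : ℝ) :
    NormedSpace.exp ((s + t) • U) = NormedSpace.exp (s • U) * NormedSpace.exp (t • U) := by
  let _ : NormedAlgebra ℚ (E →L[ℝ] E) := NormedAlgebra.restrictScalars ℚ ℝ _
  rw [add_smul]
  exact NormedSpace.exp_add_of_commute (((Commute.refl U).smul_left s).smul_right t)

theorem exp_smul_sub_one (L : E →L[ℝ] E) (r : ℝ) :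
    NormedSpace.exp (r • (L - 1)) = Real.exp (-r) • NormedSpace.exp (r • L) := by
  let _ : NormedAlgebra ℚ (E →L[ℝ] E) := NormedAlgebra.restrictScalars ℚ ℝ _
  have h1 : r • (L - 1) = algebraMap ℝ (E →L[ℝ] E) (-r) + r • L := by
    rw [Algebra.algebraMap_eq_smul_one, smul_sub, neg_smul]
    abel
  rw [h1, NormedSpace.exp_add_of_commute (Algebra.commutes _ _),
    ← NormedSpace.algebraMap_exp_comm, Algebra.algebraMap_eq_smul_one, smul_mul_assoc, one_mul,
    Real.exp_eq_exp_ℝ]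

theorem norm_exp_le_exp (U : E →L[ℝ] E) : ‖NormedSpace.exp U‖ ≤ Real.exp ‖U‖ := by
  refine (NormedSpace.exp_series_hasSum_exp' (𝕂 := ℝ) U).norm_le_of_bounded
    (g := fun n => ‖U‖ ^ n / n.factorial) ?_ ?_
  · rw [Real.exp_eq_exp_ℝ]
    exact NormedSpace.expSeries_div_hasSum_exp ‖U‖
  · intro n
    rcases n with _ | n
    -- `E` may be trivial, so the identity is only known to have norm at most `1`.
    · simp only [pow_zero, Nat.factorial_zero, Nat.cast_one, inv_one, one_smul, div_one]
      exact ContinuousLinearMap.norm_id_le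
    · rw [norm_smul, norm_inv, RCLike.norm_natCast, div_eq_inv_mul]
      gcongr
      exact norm_pow_le' U n.succ_pos

theorem norm_exp_smul_sub_one_le {L : E →L[ℝ] E} (hL : ‖L‖ ≤ 1) {r : ℝ} (hr : 0 ≤ r) :
    ‖NormedSpace.exp (r • (L - 1))‖ ≤ 1 := by
  rw [exp_smul_sub_one, norm_smul, Real.norm_of_nonneg (Real.exp_pos _).le]
  calc _ ≤ Real.exp (-r) * Real.exp r := by
        gcongr
        refine (norm_exp_le_exp _).trans (Real.exp_le_exp.2 ?_)
        rw [norm_smul, Real.norm_of_nonneg hr]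
        exact mul_le_of_le_one_right hr hL
    _ = 1 := by rw [← Real.exp_add]; simp

/-- Up to the factor `e^{-r}`, the exponential is a power series in `L` with nonnegative
coefficients, so its partial sums stay in the cone and closedness passes to the limit. -/
theorem exp_smul_sub_one_mem {P : AddSubmonoid E} (hP : IsClosed (P : Set E))
    (hsmul : ∀ r : ℝ, 0 ≤ r → ∀ f ∈ P, r • f ∈ P) {L : E →L[ℝ] E} (hL : ∀ f ∈ P, L f ∈ P)
    {r : ℝ} (hr : 0 ≤ r) {f : E} (hf : f ∈ P) : NormedSpace.exp (r • (L - 1)) f ∈ P := by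
  have key : ∀ n : ℕ, (L ^ n) f ∈ P := by
    intro n
    induction n with
    | zero => simpa using hf
    | succ n ih => rw [pow_succ']; exact hL _ ih
  rw [exp_smul_sub_one]
  refine hsmul _ (Real.exp_pos _).le _ ?_
  have hs := (NormedSpace.exp_series_hasSum_exp' (𝕂 := ℝ) (r • L)).mapL
    (ContinuousLinearMap.apply ℝ E f)
  refine hP.mem_of_tendsto hs (Eventually.of_forall fun s => sum_mem fun n _ => ?_)
  simp only [smul_pow, ContinuousLinearMap.apply_apply, smul_apply]
  exact hsmul _ (by positivity) _ (hsmul _ (by positivity) _ (key n))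

omit [CompleteSpace E] in
theorem exp_smul_comm {U V : E →L[ℝ] E} (h : Commute U V) (s : ℝ) (f : E) :
    NormedSpace.exp (s • U) (V f) = V (NormedSpace.exp (s • U) f) :=
  congrArg (fun W : E →L[ℝ] E => W f) ((h.smul_left s).exp_left).eq

/-- Two contraction semigroups with commuting bounded generators are as close as their
generators. -/
theorem norm_exp_sub_exp_le {U V : E →L[ℝ] E} (h : Commute U V)
    (hU : ∀ s : ℝ, 0 ≤ s → ‖NormedSpace.exp (s • U)‖ ≤ 1)
    (hV : ∀ s : ℝ, 0 ≤ s → ‖NormedSpace.exp (s • V)‖ ≤ 1) {t : ℝ} (ht : 0 ≤ t) (f : E) :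
    ‖NormedSpace.exp (t • U) f - NormedSpace.exp (t • V) f‖ ≤ t * ‖U f - V f‖ := by
  -- Interpolating between the two semigroups: by commutation the derivative in `s` is a product of
  -- contractions applied to `U f - V f`.
  have hd : ∀ s ∈ Icc 0 t, HasDerivWithinAt
      (fun s : ℝ => NormedSpace.exp (s • U) (NormedSpace.exp ((t - s) • V) f))
      (NormedSpace.exp (s • U) (NormedSpace.exp ((t - s) • V) (U f - V f))) (Icc 0 t) s := by
    intro s _
    have h1 := hasDerivAt_exp_smul_const (𝕂 := ℝ) U s
    have h2 := ((hasDerivAt_exp_smul_const (𝕂 := ℝ) V (t - s)).scomp s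
      ((hasDerivAt_id s).const_sub t)).clm_apply (hasDerivAt_const s f)
    refine ((h1.clm_apply h2).congr_deriv ?_).hasDerivWithinAt
    simp [exp_smul_comm h.symm, sub_eq_add_neg]
  have := norm_image_sub_le_of_norm_deriv_le_segment' hd (C := ‖U f - V f‖) (fun s hs => by
    refine ((ContinuousLinearMap.le_opNorm _ _).trans
      (mul_le_of_le_one_left (norm_nonneg _) (hU s hs.1))).trans ?_
    exact (ContinuousLinearMap.le_opNorm _ _).trans
      (mul_le_of_le_one_left (norm_nonneg _) (hV _ (by linarith [hs.2])))) t (right_mem_Icc.2 ht)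
  simpa [mul_comm] using this

end BoundedOperators

/-! ### Dissipative operators and their resolvents. -/

section MDissipative

variable {E : Type*} [NormedAddCommGroup E] [NormedSpace ℝ E]

/-- The operator `A` is m-dissipative. -/
def IsMDissipative (A : E →ₗ.[ℝ] E) : Prop :=
  (∀ l : ℝ, 0 < l → ∀ f : A.domain, l * ‖(f : E)‖ ≤ ‖l • (f : E) - A f‖) ∧
    ∀ l : ℝ, 0 < l → ∀ g : E, ∃ f : A.domain, l • (f : E) - A f = g

/-- `R` is the inverse of `l - A`. -/
structure IsResolventAt (A : E →ₗ.[ℝ] E) (l : ℝ) (R : E →L[ℝ] E) : Prop where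
  right_inv : ∀ g, ∃ hf : R g ∈ A.domain, l • R g - A ⟨R g, hf⟩ = g
  left_inv : ∀ f : A.domain, R (l • (f : E) - A f) = f
  bound : ∀ g, l * ‖R g‖ ≤ ‖g‖

theorem IsMDissipative.eq_of_sub_eq {A : E →ₗ.[ℝ] E} (hA : IsMDissipative A) {l : ℝ} (hl : 0 < l)
    {f g : A.domain} (h : l • (f : E) - A f = l • (g : E) - A g) : f = g := by
  have h1 := hA.1 l hl (f - g)
  have h2 : l • ((f - g : A.domain) : E) - A (f - g) = 0 := by
    rw [LinearPMap.map_sub, Submodule.coe_sub, smul_sub, sub_sub_sub_comm, h, sub_self]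
  rw [h2, norm_zero] at h1
  have h3 : ‖((f - g : A.domain) : E)‖ ≤ 0 := by
    by_contra h4
    exact absurd h1 (not_le.2 (mul_pos hl (not_le.1 h4)))
  exact sub_eq_zero.1 (Subtype.ext (norm_le_zero_iff.1 h3))

theorem IsMDissipative.exists_resolvent {A : E →ₗ.[ℝ] E} (hA : IsMDissipative A) {l : ℝ}
    (hl : 0 < l) : ∃ R : E →L[ℝ] E, IsResolventAt A l R := by
  choose r hr using hA.2 l hl
  have hb : ∀ g, l * ‖(r g : E)‖ ≤ ‖g‖ := fun g => by simpa [hr g] using hA.1 l hl (r g)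
  let R : E →ₗ[ℝ] E :=
    { toFun := fun g => r g
      map_add' := fun g h => by
        rw [← Submodule.coe_add]
        refine congrArg _ (hA.eq_of_sub_eq hl ?_)
        rw [hr, LinearPMap.map_add, Submodule.coe_add, smul_add, add_sub_add_comm, hr, hr]
      map_smul' := fun s g => by
        rw [RingHom.id_apply, ← Submodule.coe_smul]
        refine congrArg _ (hA.eq_of_sub_eq hl ?_)
        rw [hr, LinearPMap.map_smul, Submodule.coe_smul, smul_comm l s, ← smul_sub, hr] }
  refine ⟨R.mkContinuous l⁻¹ fun g => ?_, fun g => ⟨(r g).2, hr g⟩, fun f => ?_, hb⟩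
  · rw [inv_mul_eq_div, le_div_iff₀ hl, mul_comm]
    exact hb g
  · exact congrArg Subtype.val (hA.eq_of_sub_eq hl (hr _))

theorem IsResolventAt.norm_smul_le {A : E →ₗ.[ℝ] E} {l : ℝ} {R : E →L[ℝ] E}
    (hR : IsResolventAt A l R) (hl : 0 < l) : ‖l • R‖ ≤ 1 :=
  ContinuousLinearMap.opNorm_le_bound _ zero_le_one fun g => by
    rw [smul_apply, norm_smul, Real.norm_of_nonneg hl.le, one_mul]
    exact hR.bound g

/-- The resolvent identity, written once for each order of the pair, and subtracted. -/
theorem IsResolventAt.commute {A : E →ₗ.[ℝ] E} {l m : ℝ} {R Q : E →L[ℝ] E}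
    (hR : IsResolventAt A l R) (hQ : IsResolventAt A m Q) (hlm : l ≠ m) : Commute R Q := by
  have key : ∀ {l m : ℝ} {R Q : E →L[ℝ] E}, IsResolventAt A l R → IsResolventAt A m Q →
      ∀ g, Q g = R g + (l - m) • R (Q g) := by
    intro l m R Q hR hQ g
    obtain ⟨hf, h⟩ := hQ.right_inv g
    have h1 := hR.left_inv ⟨Q g, hf⟩
    have h2 : l • Q g - A ⟨Q g, hf⟩ = g + (l - m) • Q g := by
      have h' : A ⟨Q g, hf⟩ = m • Q g - g := by rw [eq_sub_iff_add_eq, ← eq_sub_iff_add_eq', h]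
      rw [h', sub_smul]
      abel
    rw [← map_smul, ← map_add, ← h2]
    exact h1.symm
  ext g
  have h1 := key hR hQ g
  have h2 := key hQ hR g
  have h3 : (l - m) • (R (Q g) - Q (R g)) = 0 := by
    have : (l - m) • (R (Q g) - Q (R g)) = (l - m) • R (Q g) + (m - l) • Q (R g) := by
      rw [smul_sub, ← neg_sub l m, neg_smul, sub_eq_add_neg]
    rw [this, ← sub_eq_iff_eq_add'.2 h1, ← sub_eq_iff_eq_add'.2 h2]
    abel
  exact sub_eq_zero.1 ((smul_eq_zero.1 h3).resolve_left (sub_ne_zero.2 hlm))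

/-- The generator of a contraction semigroup is dissipative. -/
theorem dissipative_of_tendsto {T : ℝ≥0 → E →L[ℝ] E} (hT : ∀ t f, ‖T t f‖ ≤ ‖f‖) {f g : E}
    (h : Tendsto (fun t : ℝ≥0 => (t : ℝ)⁻¹ • (T t f - f)) (𝓝[>] 0) (𝓝 g)) {l : ℝ} (hl : 0 < l) :
    l * ‖f‖ ≤ ‖l • f - g‖ := by
  refine ge_of_tendsto (h.const_sub (l • f)).norm (eventually_nhdsWithin_of_forall fun t ht => ?_)
  have ht' : (0 : ℝ) < t := ht
  have e : l • f - (t : ℝ)⁻¹ • (T t f - f) = (l + (t : ℝ)⁻¹) • f - (t : ℝ)⁻¹ • T t f := by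
    rw [smul_sub, add_smul]; abel
  rw [e]
  refine le_trans ?_ (norm_sub_norm_le _ _)
  rw [norm_smul, norm_smul, Real.norm_of_nonneg (by positivity), Real.norm_of_nonneg (by positivity)]
  have := mul_le_mul_of_nonneg_left (hT t f) (inv_nonneg.2 ht'.le)
  linarith

/-- An m-dissipative operator has no proper dissipative extension: `1 - A` is already onto, and the
generator of `T`, being dissipative, makes `1` minus it injective. So differentiability of `T` on
the domain of `A` is enough. -/
theorem IsMDissipative.isGeneratorOf {A : E →ₗ.[ℝ] E} (hA : IsMDissipative A)
    {T : ℝ≥0 → E →L[ℝ] E} (hT : ∀ t f, ‖T t f‖ ≤ ‖f‖)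
    (h : ∀ f : A.domain, Tendsto (fun t : ℝ≥0 => (t : ℝ)⁻¹ • (T t f - f)) (𝓝[>] 0) (𝓝 (A f))) :
    IsGeneratorOf A T := by
  refine fun f g => ⟨?_, fun hg => ?_⟩
  · rintro ⟨hf, rfl⟩
    exact h ⟨f, hf⟩
  · obtain ⟨u, hu⟩ := hA.2 1 one_pos ((1 : ℝ) • f - g)
    have h1 := dissipative_of_tendsto hT (f := f - u) (g := g - A u)
      ((hg.sub (h u)).congr fun t => by rw [map_sub, ← smul_sub]; congr 1; abel) one_pos
    have h2 : (1 : ℝ) • (f - (u : E)) - (g - A u) = 0 := by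
      rw [smul_sub, sub_sub_sub_comm, hu, sub_self]
    rw [h2, norm_zero, one_mul, norm_le_zero_iff, sub_eq_zero] at h1
    subst h1
    exact ⟨u.2, (sub_right_injective hu)⟩

/-- Contractions that converge to a contraction pointwise on a dense set
converge strongly. -/
theorem tendsto_of_dense {ι : Type*} {l : Filter ι} {U : ι → E →L[ℝ] E} {V : E →L[ℝ] E}
    (hU : ∀ᶠ i in l, ∀ f, ‖U i f‖ ≤ ‖f‖)
    (hV : ∀ f, ‖V f‖ ≤ ‖f‖) {D : Set E} (hD : Dense D)
    (h : ∀ f ∈ D, Tendsto (fun i => U i f) l (𝓝 (V f))) (f : E) :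
    Tendsto (fun i => U i f) l (𝓝 (V f)) := by
  rw [Metric.tendsto_nhds]
  intro ε hε
  obtain ⟨g, hg, hfg⟩ := hD.exists_dist_lt f (show 0 < ε / 3 by positivity)
  filter_upwards [hU, Metric.tendsto_nhds.1 (h g hg) (ε / 3) (by positivity)] with i h1 h2
  rw [dist_eq_norm] at *
  have e : U i f - V f = U i (f - g) + (U i g - V g) - V (f - g) := by simp only [map_sub]; abel
  rw [e]
  have h4 := h1 (f - g)
  have h5 := hV (f - g)
  linarith [norm_sub_le (U i (f - g) + (U i g - V g)) (V (f - g)),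
    norm_add_le (U i (f - g)) (U i g - V g)]

end MDissipative

/-! ### Hille–Yosida by Yosida approximation. -/

section HilleYosida

variable {E : Type*} [NormedAddCommGroup E] [NormedSpace ℝ E] [CompleteSpace E]

/-- The Hille–Yosida theorem for contraction semigroups, with invariance of resolvent-invariant closed
convex cones. -/
theorem IsMDissipative.exists_semigroup {A : E →ₗ.[ℝ] E} (hA : IsMDissipative A)
    (hd : Dense (A.domain : Set E)) :
    ∃ T : ℝ≥0 → E →L[ℝ] E, (∀ f, T 0 f = f) ∧ (∀ s t f, T (s + t) f = T s (T t f)) ∧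
      (∀ t f, ‖T t f‖ ≤ ‖f‖) ∧ (∀ f, Continuous fun t => T t f) ∧ IsGeneratorOf A T ∧
      ∀ P : AddSubmonoid E, IsClosed (P : Set E) → (∀ r : ℝ, 0 ≤ r → ∀ f ∈ P, r • f ∈ P) →
        (∀ l : ℝ, 0 < l → ∀ f : A.domain, l • (f : E) - A f ∈ P → (f : E) ∈ P) →
        ∀ t, ∀ f ∈ P, T t f ∈ P := by
  have hpos : ∀ n : ℕ, (0 : ℝ) < n + 1 := fun n => by positivity
  choose R hR using fun n : ℕ => hA.exists_resolvent (hpos n)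
  -- Yosida approximations at `λ = n + 1`, positive also for `n = 0`: `L n = λ R n` is a
  -- contraction, and `B n = λ (L n - 1)` equals `L n A` on the domain of `A`.
  let L : ℕ → E →L[ℝ] E := fun n => ((n : ℝ) + 1) • R n
  let B : ℕ → E →L[ℝ] E := fun n => ((n : ℝ) + 1) • (L n - 1)
  let S : ℕ → ℝ → E →L[ℝ] E := fun n t => NormedSpace.exp (t • B n)
  have hL : ∀ n, ‖L n‖ ≤ 1 := fun n => (hR n).norm_smul_le (hpos n)
  have hS : ∀ n t, 0 ≤ t → ‖S n t‖ ≤ 1 := fun n t ht => by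
    simp only [S, B, smul_smul]
    exact norm_exp_smul_sub_one_le (hL n) (mul_nonneg ht (hpos n).le)
  have hSf : ∀ n t, 0 ≤ t → ∀ f, ‖S n t f‖ ≤ ‖f‖ := fun n t ht f =>
    ((S n t).le_opNorm f).trans (mul_le_of_le_one_left (norm_nonneg _) (hS n t ht))
  have hcomm : ∀ m n, Commute (B m) (B n) := by
    intro m n
    rcases eq_or_ne m n with rfl | hmn
    · exact Commute.refl _
    · have h := (hR m).commute (hR n) (by simpa using hmn)
      have h1 : Commute (L m) (L n) := (h.smul_left _).smul_right _
      exact (((h1.sub_left (Commute.one_left _)).sub_right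
        ((Commute.one_right _).sub_left (Commute.one_right _))).smul_left _).smul_right _
  have hLA : ∀ n (f : A.domain), L n f - f = R n (A f) := by
    intro n f
    have h := (hR n).left_inv f
    rw [map_sub, map_smul] at h
    rw [sub_eq_iff_eq_add', ← sub_eq_iff_eq_add]
    exact h
  have hB : ∀ n (f : A.domain), B n f = L n (A f) := by
    intro n f
    simp only [B, smul_apply, sub_apply, one_apply_eq_self, hLA]
    rfl
  have hLlim : ∀ f, Tendsto (fun n => L n f) atTop (𝓝 f) := by
    refine tendsto_of_dense (V := ContinuousLinearMap.id ℝ E) (Eventually.of_forall fun n f =>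
      ((L n).le_opNorm f).trans (mul_le_of_le_one_left (norm_nonneg _) (hL n)))
      (fun f => le_rfl) hd fun f hf => ?_
    rw [tendsto_iff_norm_sub_tendsto_zero]
    refine squeeze_zero (fun _ => norm_nonneg _) (g := fun n : ℕ => ‖A ⟨f, hf⟩‖ * (1 / ((n : ℝ) + 1)))
      (fun n => ?_) (by simpa using tendsto_one_div_add_atTop_nhds_zero_nat.const_mul ‖A ⟨f, hf⟩‖)
    have h1 := (hR n).bound (A ⟨f, hf⟩)
    rw [ContinuousLinearMap.id_apply, hLA n ⟨f, hf⟩, mul_one_div, le_div_iff₀ (hpos n), mul_comm]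
    exact h1
  have hBlim : ∀ f : A.domain, Tendsto (fun n => B n f) atTop (𝓝 (A f)) := fun f => by
    simp only [hB]
    exact hLlim _
  have hdiff : ∀ m n t, 0 ≤ t → ∀ f, ‖S m t f - S n t f‖ ≤ t * ‖B m f - B n f‖ :=
    fun m n t ht f => norm_exp_sub_exp_le (hcomm m n) (hS m) (hS n) ht f
  have hcau : ∀ t : ℝ≥0, ∀ f, CauchySeq fun n => S n t f := by
    intro t f
    rw [Metric.cauchySeq_iff]
    intro ε hε
    obtain ⟨g, hg, hfg⟩ := hd.exists_dist_lt f (show 0 < ε / 3 by positivity)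
    have h1 : Tendsto (fun p : ℕ × ℕ => (t : ℝ) * ‖B p.1 g - B p.2 g‖) atTop (𝓝 0) := by
      have := (((hBlim ⟨g, hg⟩).comp tendsto_fst).sub ((hBlim ⟨g, hg⟩).comp tendsto_snd)).norm
      rw [prod_atTop_atTop_eq] at this
      simpa using this.const_mul (t : ℝ)
    obtain ⟨N, hN⟩ := eventually_atTop_prod_self.1 (h1.eventually_lt_const (show 0 < ε / 3 by positivity))
    refine ⟨N, fun m hm n hn => ?_⟩
    rw [dist_eq_norm] at *
    have h2 := (hdiff m n t t.2 g).trans_lt (hN m n hm hn)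
    have h3 := hSf m t t.2 (f - g)
    have h4 := hSf n t t.2 (f - g)
    have e : S m t f - S n t f = S m t (f - g) + (S m t g - S n t g) - S n t (f - g) := by
      simp only [map_sub]; abel
    rw [e]
    linarith [norm_sub_le (S m t (f - g) + (S m t g - S n t g)) (S n t (f - g)),
      norm_add_le (S m t (f - g)) (S m t g - S n t g)]
  choose T' hT' using fun t f => cauchySeq_tendsto_of_complete (hcau t f)
  have hT'c : ∀ t f, ‖T' t f‖ ≤ ‖f‖ := fun t f =>
    le_of_tendsto (hT' t f).norm (Eventually.of_forall fun n => hSf n t t.2 f)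
  let T : ℝ≥0 → E →L[ℝ] E := fun t =>
    LinearMap.mkContinuous
      { toFun := T' t
        map_add' := fun f g => tendsto_nhds_unique (hT' t (f + g))
          (((hT' t f).add (hT' t g)).congr fun n => (map_add (S n t) f g).symm)
        map_smul' := fun r f => tendsto_nhds_unique (hT' t (r • f))
          (((hT' t f).const_smul r).congr fun n => (map_smul (S n t) r f).symm) } 1
      (fun f => by rw [one_mul]; exact hT'c t f)
  have hT : ∀ (t : ℝ≥0) f, Tendsto (fun n => S n t f) atTop (𝓝 (T t f)) := hT'
  have hTc : ∀ t f, ‖T t f‖ ≤ ‖f‖ := hT'c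
  -- The limit `m → ∞` in `hdiff`. The bound is linear in `t`, so it survives division by `t` and
  -- identifies the derivative at `0`.
  have hTS : ∀ n (t : ℝ≥0) (f : A.domain), ‖T t f - S n t f‖ ≤ t * ‖A f - B n f‖ := fun n t f =>
    le_of_tendsto_of_tendsto ((hT t f).sub_const _).norm
      (((hBlim f).sub_const _).norm.const_mul (t : ℝ))
      (Eventually.of_forall fun m => hdiff m n t t.2 f)
  have hScont : ∀ n f, Continuous fun t : ℝ => S n t f := fun n f =>
    continuous_iff_continuousAt.2 fun t =>
      ((hasDerivAt_exp_smul_const (𝕂 := ℝ) (B n) t).clm_apply (hasDerivAt_const t f)).continuousAt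
  have hTcontD : ∀ f : A.domain, Continuous fun t : ℝ≥0 => T t f := by
    intro f
    rw [continuous_iff_continuousAt]
    intro t₀
    refine ContinuousOn.continuousAt (s := Iic (t₀ + 1)) ?_ (Iic_mem_nhds (by simp))
    refine continuousOn_of_uniform_approx_of_continuousOn fun u hu => ?_
    obtain ⟨ε, hε, hεu⟩ := Metric.mem_uniformity_dist.1 hu
    have h1 : Tendsto (fun n => ((t₀ + 1 : ℝ≥0) : ℝ) * ‖A f - B n f‖) atTop (𝓝 0) := by
      simpa using (((hBlim f).const_sub (A f)).norm.const_mul ((t₀ + 1 : ℝ≥0) : ℝ))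
    obtain ⟨n, hn⟩ := (h1.eventually_lt_const hε).exists
    refine ⟨fun t => S n t f, ((hScont n f).comp NNReal.continuous_coe).continuousOn,
      fun t ht => hεu ?_⟩
    rw [dist_eq_norm]
    exact ((hTS n t f).trans (mul_le_mul_of_nonneg_right (NNReal.coe_le_coe.2 ht)
      (norm_nonneg _))).trans_lt hn
  refine ⟨T, fun f => ?_, fun s t f => ?_, hTc, fun f => ?_, ?_, ?_⟩
  · refine tendsto_nhds_unique (hT 0 f) ?_
    simp [S]
  · refine tendsto_nhds_unique (hT (s + t) f) ?_
    have e : ∀ n, S n (s + t : ℝ≥0) f = S n s (S n t f - T t f) + S n s (T t f) := by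
      intro n
      rw [← map_add, sub_add_cancel, NNReal.coe_add]
      simp only [S]
      rw [exp_add_smul]
      rfl
    simp only [e]
    rw [← zero_add (T s (T t f))]
    refine Tendsto.add ?_ (hT s _)
    refine squeeze_zero_norm (fun n => hSf n s s.2 _) ?_
    simpa using ((hT t f).sub_const (T t f)).norm
  · refine continuous_of_uniform_approx_of_continuous fun u hu => ?_
    obtain ⟨ε, hε, hεu⟩ := Metric.mem_uniformity_dist.1 hu
    obtain ⟨g, hg, hfg⟩ := hd.exists_dist_lt f hε
    refine ⟨fun t => T t g, hTcontD ⟨g, hg⟩, fun t => hεu ?_⟩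
    rw [dist_eq_norm, ← map_sub]
    exact (hTc t _).trans_lt (by rwa [← dist_eq_norm])
  · refine hA.isGeneratorOf hTc fun f => ?_
    rw [Metric.tendsto_nhds]
    intro ε hε
    have h1 : Tendsto (fun n => ‖A f - B n f‖) atTop (𝓝 0) := by
      simpa using ((hBlim f).const_sub (A f)).norm
    obtain ⟨n, hn⟩ := (h1.eventually_lt_const (show 0 < ε / 3 by positivity)).exists
    have h2 : Tendsto (fun t : ℝ≥0 => (t : ℝ)⁻¹ • (S n t f - f)) (𝓝[>] 0) (𝓝 (B n f)) := by
      have hd0 := (hasDerivAt_exp_smul_const (𝕂 := ℝ) (B n) 0).clm_apply (hasDerivAt_const 0 (f : E))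
      have h3 := (hasDerivWithinAt_iff_tendsto_slope' (s := Ioi (0 : ℝ)) (by simp)).1
        hd0.hasDerivWithinAt
      have h4 : Tendsto (fun t : ℝ≥0 => (t : ℝ)) (𝓝[>] 0) (𝓝[>] 0) :=
        tendsto_nhdsWithin_iff.2 ⟨(NNReal.continuous_coe.tendsto' 0 0 rfl).mono_left
          nhdsWithin_le_nhds, eventually_nhdsWithin_of_forall fun t ht => ht⟩
      have h5 := h3.comp h4
      simpa [slope_def_module, S, Function.comp_def, NormedSpace.exp_zero] using h5
    filter_upwards [Metric.tendsto_nhds.1 h2 (ε / 3) (by positivity), self_mem_nhdsWithin] with t h6 ht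
    have ht' : (0 : ℝ) < t := ht
    rw [dist_eq_norm] at *
    have e : (t : ℝ)⁻¹ • (T t f - f) - A f = (t : ℝ)⁻¹ • (T t f - S n t f) +
        ((t : ℝ)⁻¹ • (S n t f - f) - B n f) - (A f - B n f) := by
      simp only [smul_sub]; abel
    have h7 : ‖(t : ℝ)⁻¹ • (T t f - S n t f)‖ ≤ ‖A f - B n f‖ := by
      rw [norm_smul, Real.norm_of_nonneg (inv_nonneg.2 ht'.le), inv_mul_eq_div, div_le_iff₀' ht']
      exact hTS n t f
    rw [e]
    linarith [norm_sub_le ((t : ℝ)⁻¹ • (T t f - S n t f) + ((t : ℝ)⁻¹ • (S n t f - f) - B n f))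
      (A f - B n f), norm_add_le ((t : ℝ)⁻¹ • (T t f - S n t f)) ((t : ℝ)⁻¹ • (S n t f - f) - B n f)]
  · intro P hP hsmul hres t f hf
    refine hP.mem_of_tendsto (hT t f) (Eventually.of_forall fun n => ?_)
    simp only [S, B, smul_smul]
    refine exp_smul_sub_one_mem hP hsmul (fun g hg => ?_) (mul_nonneg t.2 (hpos n).le) hf
    obtain ⟨h1, h2⟩ := (hR n).right_inv g
    exact hsmul _ (hpos n).le _ (hres _ (hpos n) ⟨_, h1⟩ (by rw [h2]; exact hg))

end HilleYosida

/-! ### Convergence of semigroups from convergence of generators. -/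

section TrotterKato

variable {E : Type*} [NormedAddCommGroup E] [NormedSpace ℝ E]

/-- A strongly continuous semigroup of contractions. -/
structure IsContractionSemigroup (T : ℝ≥0 → E →L[ℝ] E) : Prop where
  zero : ∀ f, T 0 f = f
  add : ∀ s t f, T (s + t) f = T s (T t f)
  contraction : ∀ t f, ‖T t f‖ ≤ ‖f‖
  continuous : ∀ f, Continuous fun t => T t f

theorem IsContractionSemigroup.tendsto {T : ℝ≥0 → E →L[ℝ] E} (hT : IsContractionSemigroup T)
    {ι : Type*} {l : Filter ι} {u : ι → ℝ≥0} {v : ι → E} {u₀ : ℝ≥0} {v₀ : E}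
    (hu : Tendsto u l (𝓝 u₀)) (hv : Tendsto v l (𝓝 v₀)) :
    Tendsto (fun i => T (u i) (v i)) l (𝓝 (T u₀ v₀)) := by
  have e : ∀ i, T (u i) (v i) = T (u i) (v i - v₀) + T (u i) v₀ := fun i => by
    rw [← map_add, sub_add_cancel]
  simp only [e]
  rw [← zero_add (T u₀ v₀)]
  refine Tendsto.add ?_ (((hT.continuous v₀).tendsto u₀).comp hu)
  refine squeeze_zero_norm (fun i => hT.contraction _ _) ?_
  simpa using (hv.sub_const v₀).norm

theorem IsResolventAt.tendsto {A : E →ₗ.[ℝ] E} {R : E →L[ℝ] E} (hR : IsResolventAt A 1 R)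
    {T : ℝ≥0 → E →L[ℝ] E} (hA : IsGeneratorOf A T) (g : E) :
    Tendsto (fun t : ℝ≥0 => (t : ℝ)⁻¹ • (T t (R g) - R g)) (𝓝[>] 0) (𝓝 (R g - g)) := by
  obtain ⟨hf, h⟩ := hR.right_inv g
  refine (hA _ _).1 ⟨hf, ?_⟩
  rw [one_smul] at h
  nth_rewrite 3 [← h]
  abel

/-- The semigroup maps the domain of its generator to itself and commutes with the generator there;
applying `R` to `(1 - A) T t (R g) = T t g` gives the claim. -/
theorem IsResolventAt.comm {A : E →ₗ.[ℝ] E} {R : E →L[ℝ] E} (hR : IsResolventAt A 1 R)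
    {T : ℝ≥0 → E →L[ℝ] E} (hT : IsContractionSemigroup T) (hA : IsGeneratorOf A T) (t : ℝ≥0)
    (g : E) : R (T t g) = T t (R g) := by
  have h1 := (((T t).continuous.tendsto _).comp (hR.tendsto hA g)).congr (f₂ :=
      fun s : ℝ≥0 => (s : ℝ)⁻¹ • (T s (T t (R g)) - T t (R g))) fun s => by
    simp only [Function.comp_apply, map_smul, map_sub]
    rw [← hT.add, ← hT.add, add_comm]
  obtain ⟨hf, h2⟩ := (hA _ _).2 h1
  have h3 := hR.left_inv ⟨_, hf⟩
  rw [h2, one_smul, map_sub (T t), sub_sub_cancel] at h3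
  exact h3

/-- Duhamel's formula between two resolvents: `s ↦ S(t - s) Q T(s) R f` is differentiable from the
right, and since `A R = R - 1` and `B Q = Q - 1` its derivative is `S(t - s) (R - Q) T(s) f`, in
which no unbounded operator remains. -/
theorem norm_resolvent_semigroup_sub_le {A B : E →ₗ.[ℝ] E} {R Q : E →L[ℝ] E}
    (hR : IsResolventAt A 1 R) (hQ : IsResolventAt B 1 Q) {T S : ℝ≥0 → E →L[ℝ] E}
    (hT : IsContractionSemigroup T) (hS : IsContractionSemigroup S)
    (hA : IsGeneratorOf A T) (hB : IsGeneratorOf B S) (t : ℝ≥0) (f : E) {η : ℝ}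
    (h : ∀ s ≤ t, ‖R (T s f) - Q (T s f)‖ ≤ η) :
    ‖Q (T t (R f)) - Q (S t (R f))‖ ≤ η * t := by
  let φ : ℝ → E := fun s => S (t - s).toNNReal (Q (T s.toNNReal (R f)))
  have hφ : Continuous φ := continuous_iff_continuousAt.2 fun s =>
    hS.tendsto ((continuous_real_toNNReal.comp (continuous_const.sub continuous_id)).tendsto s)
      ((Q.continuous.comp ((hT.continuous (R f)).comp continuous_real_toNNReal)).tendsto s)
  have hd : ∀ s ∈ Ico (0 : ℝ) t, HasDerivWithinAt φ
      (S (t - s).toNNReal (R (T s.toNNReal f) - Q (T s.toNNReal f))) (Ici s) s := by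
    intro s hs
    rw [← hasDerivWithinAt_Ioi_iff_Ici, hasDerivWithinAt_iff_tendsto_slope' (by simp)]
    have hh : Tendsto (fun z : ℝ => (z - s).toNNReal) (𝓝[>] s) (𝓝[>] 0) := by
      refine tendsto_nhdsWithin_iff.2 ⟨((continuous_real_toNNReal.comp
        (continuous_id.sub continuous_const)).tendsto' s 0 (by simp)).mono_left nhdsWithin_le_nhds,
        eventually_nhdsWithin_of_forall fun z hz => ?_⟩
      simpa using hz
    set w := T s.toNNReal (R f) with hw
    have hw' : w = R (T s.toNNReal f) := (hR.comm hT hA _ _).symm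
    have h1 := (Q.continuous.tendsto _).comp ((hR.tendsto hA (T s.toNNReal f)).comp hh)
    have h2 := (hQ.tendsto hB w).comp hh
    have h3 := hS.tendsto (u := fun z : ℝ => (t - z).toNNReal)
      (((continuous_real_toNNReal.comp (continuous_const.sub continuous_id)).tendsto s).mono_left
      nhdsWithin_le_nhds) (h1.sub h2)
    have e : Q (R (T s.toNNReal f) - T s.toNNReal f) - (Q w - w) =
        R (T s.toNNReal f) - Q (T s.toNNReal f) := by
      rw [hw', map_sub]
      abel
    rw [e] at h3
    refine h3.congr' ?_
    filter_upwards [Ioo_mem_nhdsGT hs.2] with z hz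
    have hz1 : ((z - s).toNNReal : ℝ) = z - s := Real.coe_toNNReal _ (by linarith [hz.1])
    have hz2 : (t - s : ℝ).toNNReal = (t - z : ℝ).toNNReal + (z - s).toNNReal := by
      rw [← Real.toNNReal_add (by linarith [hz.2]) (by linarith [hz.1])]
      congr 1
      ring
    have hz3 : z.toNNReal = (z - s).toNNReal + s.toNNReal := by
      rw [← Real.toNNReal_add (by linarith [hz.1]) hs.1]
      congr 1
      ring
    simp only [slope_def_module, φ, Function.comp_apply, hz1, hz2, hS.add]
    rw [hz3, hT.add, ← hw', ← map_sub, ← map_smul]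
    simp only [map_smul, map_sub, smul_sub, ← hw]
    abel
  have := norm_image_sub_le_of_norm_deriv_right_le_segment hφ.continuousOn hd (C := η)
    (fun s hs => (hS.contraction _ _).trans (h _ (Real.toNNReal_le_iff_le_coe.2 hs.2.le)))
    t (right_mem_Icc.2 t.2)
  simp only [φ, sub_self, Real.toNNReal_zero, hS.zero, hT.zero, sub_zero, Real.toNNReal_coe,
    ← hQ.comm hS hB] at this
  exact this

/-- A form of the Trotter–Kato theorem: convergence of the generators in the sense of graphs implies
convergence of the semigroups. -/
theorem tendstoUniformlyOn_semigroup {ι : Type*} {l : Filter ι} {A : E →ₗ.[ℝ] E}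
    {B : ι → E →ₗ.[ℝ] E} {T : ℝ≥0 → E →L[ℝ] E} {S : ι → ℝ≥0 → E →L[ℝ] E}
    (hA : IsMDissipative A) (hd : Dense (A.domain : Set E)) (hT : IsContractionSemigroup T)
    (hAT : IsGeneratorOf A T) (hB : ∀ᶠ i in l, IsMDissipative (B i))
    (hS : ∀ᶠ i in l, IsContractionSemigroup (S i)) (hBS : ∀ᶠ i in l, IsGeneratorOf (B i) (S i))
    (hgraph : ∀ f : A.domain, ∃ F G : ι → E,
      (∀ᶠ i in l, ∃ hF : F i ∈ (B i).domain, B i ⟨F i, hF⟩ = G i) ∧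
        Tendsto F l (𝓝 (f : E)) ∧ Tendsto G l (𝓝 (A f)))
    (f : E) (t₀ : ℝ≥0) :
    TendstoUniformlyOn (fun i t => S i t f) (fun t => T t f) l (Iic t₀) := by
  obtain ⟨R, hR⟩ := hA.exists_resolvent one_pos
  have hR1 : ∀ g, ‖R g‖ ≤ ‖g‖ := fun g => by simpa using hR.bound g
  -- m-dissipativity holds only eventually along `l`; elsewhere the value `0` is arbitrary.
  have hQ' : ∀ i, ∃ Q : E →L[ℝ] E, IsMDissipative (B i) → IsResolventAt (B i) 1 Q := fun i => by
    by_cases h : IsMDissipative (B i)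
    · obtain ⟨Q, hQ⟩ := h.exists_resolvent one_pos
      exact ⟨Q, fun _ => hQ⟩
    · exact ⟨0, fun h' => absurd h' h⟩
  choose Q hQ' using hQ'
  have hQ : ∀ᶠ i in l, IsResolventAt (B i) 1 (Q i) := hB.mono fun i hi => hQ' i hi
  have hQ1 : ∀ᶠ i in l, ∀ g, ‖Q i g‖ ≤ ‖g‖ := hQ.mono fun i hi g => by simpa using hi.bound g
  have hQR : ∀ g, Tendsto (fun i => Q i g) l (𝓝 (R g)) := by
    intro g
    obtain ⟨hf, hg⟩ := hR.right_inv g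
    obtain ⟨F, G, hFG, hF, hG⟩ := hgraph ⟨R g, hf⟩
    have h1 : Tendsto (fun i => ‖g - (F i - G i)‖ + ‖F i - R g‖) l (𝓝 0) := by
      have := ((hF.sub hG).const_sub g).norm.add (hF.sub_const (R g)).norm
      rw [one_smul] at hg
      simpa [hg] using this
    rw [tendsto_iff_norm_sub_tendsto_zero]
    refine squeeze_zero' (Eventually.of_forall fun _ => norm_nonneg _) ?_ h1
    filter_upwards [hQ, hQ1, hFG] with i h2 h3 ⟨h4, h5⟩
    have h6 := h2.left_inv ⟨F i, h4⟩
    rw [one_smul, h5] at h6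
    have e : Q i g - R g = Q i (g - (F i - G i)) + (F i - R g) := by
      rw [map_sub, h6]
      abel
    rw [e]
    exact (norm_add_le _ _).trans (by gcongr; exact h3 _)
  -- Strong convergence of contractions is uniform on compact sets, here on the orbit of `g` over
  -- `[0, t₀]`.
  have hunif : ∀ g, ∀ η : ℝ, 0 < η → ∀ᶠ i in l, ∀ s ≤ t₀, ‖R (T s g) - Q i (T s g)‖ ≤ η := by
    intro g η hη
    have hK : IsCompact ((fun s => T s g) '' Icc 0 t₀) := isCompact_Icc.image (hT.continuous g)
    obtain ⟨K, -, hKfin, hKc⟩ := hK.finite_cover_balls (show 0 < η / 3 by positivity)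
    have h1 : ∀ᶠ i in l, ∀ x ∈ K, ‖R x - Q i x‖ < η / 3 := by
      refine (eventually_all_finite hKfin).2 fun x _ => ?_
      have := ((hQR x).const_sub (R x)).norm
      rw [sub_self, norm_zero] at this
      exact this.eventually_lt_const (by positivity)
    filter_upwards [h1, hQ1] with i h2 h3 s hs
    obtain ⟨x, hx, hsx⟩ := mem_iUnion₂.1 (hKc ⟨s, ⟨zero_le, hs⟩, rfl⟩)
    rw [Metric.mem_ball, dist_eq_norm] at hsx
    have e : R (T s g) - Q i (T s g) = R (T s g - x) + (R x - Q i x) - Q i (T s g - x) := by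
      simp only [map_sub]; abel
    rw [e]
    linarith [norm_sub_le (R (T s g - x) + (R x - Q i x)) (Q i (T s g - x)), h2 x hx,
      norm_add_le (R (T s g - x)) (R x - Q i x), hR1 (T s g - x), h3 (T s g - x)]
  -- On the range of `R ∘ R`, one factor `R` is needed inside the Duhamel bound and the other is
  -- exchanged for `Q i`.
  have hRR : ∀ g, ∀ η : ℝ, 0 < η → ∀ᶠ i in l, ∀ t ≤ t₀, ‖T t (R (R g)) - S i t (R (R g))‖ < η := by
    intro g η hη
    have h1 : ∀ᶠ i in l, ‖Q i (R g) - R (R g)‖ < η / 4 := by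
      have := ((hQR (R g)).sub_const (R (R g))).norm
      rw [sub_self, norm_zero] at this
      exact this.eventually_lt_const (by positivity)
    filter_upwards [h1, hunif (R g) (η / 4) (by positivity),
      hunif g (η / 4 / (t₀ + 1)) (by positivity), hQ, hS, hBS] with i h1 h2 h3 h4 h5 h6 t ht
    have h7 := norm_resolvent_semigroup_sub_le hR h4 hT h5 hAT h6 t g
      fun s hs => h3 s (hs.trans ht)
    have h8 : η / 4 / (t₀ + 1) * (t : ℝ) ≤ η / 4 := by
      rw [div_mul_eq_mul_div, div_le_iff₀ (by positivity)]
      have : (t : ℝ) ≤ t₀ + 1 := by linarith [NNReal.coe_le_coe.2 ht]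
      gcongr
    have h9 := h5.contraction t (Q i (R g) - R (R g))
    have e : T t (R (R g)) - S i t (R (R g)) = (R (T t (R g)) - Q i (T t (R g))) +
        (Q i (T t (R g)) - Q i (S i t (R g))) + S i t (Q i (R g) - R (R g)) := by
      rw [hR.comm hT hAT, h4.comm h5 h6, map_sub (S i t)]
      abel
    rw [e]
    linarith [norm_add₃_le (a := R (T t (R g)) - Q i (T t (R g)))
      (b := Q i (T t (R g)) - Q i (S i t (R g))) (c := S i t (Q i (R g) - R (R g))), h2 t ht]
  have hdR : DenseRange R := hd.mono fun f hf => ⟨_, hR.left_inv ⟨f, hf⟩⟩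
  have hdRR : DenseRange (R ∘ R) := hdR.comp hdR R.continuous
  rw [Metric.tendstoUniformlyOn_iff]
  intro ε hε
  obtain ⟨g, hg⟩ := hdRR.exists_dist_lt f (show 0 < ε / 3 by positivity)
  filter_upwards [hRR g (ε / 3) (by positivity), hS] with i h1 h2 t ht
  rw [dist_eq_norm] at *
  set h := R (R g)
  have e : T t f - S i t f = T t (f - h) + (T t h - S i t h) - S i t (f - h) := by
    simp only [map_sub]; abel
  rw [e]
  have hg' : ‖f - h‖ < ε / 3 := hg
  linarith [norm_sub_le (T t (f - h) + (T t h - S i t h)) (S i t (f - h)), h1 t ht,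
    norm_add_le (T t (f - h)) (T t h - S i t h), hT.contraction t (f - h), h2.contraction t (f - h)]

end TrotterKato

/-! ### The minimum principle and Feller generators. -/

section PositiveMinimum

variable {K : Type*} [TopologicalSpace K] [CompactSpace K]

/-- The nonpositive minimum principle: `A f` is nonnegative wherever `f` attains a nonpositive
minimum. -/
def HasMinimumPrinciple (A : C(K, ℝ) →ₗ.[ℝ] C(K, ℝ)) : Prop :=
  ∀ (f : A.domain) (x₀ : K), (∀ x, (f : C(K, ℝ)) x₀ ≤ (f : C(K, ℝ)) x) →
    (f : C(K, ℝ)) x₀ ≤ 0 → 0 ≤ A f x₀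

/-- At a nonpositive minimum `A f ≥ 0`, so `l f ≥ l f - A f ≥ -M` there; a positive minimum needs no
argument. `M = 0` gives positivity of the resolvent, and `M = ‖l f - A f‖` gives dissipativity. -/
theorem HasMinimumPrinciple.le {A : C(K, ℝ) →ₗ.[ℝ] C(K, ℝ)} (hA : HasMinimumPrinciple A) {l : ℝ}
    (hl : 0 < l) (f : A.domain) {M : ℝ} (hM : 0 ≤ M)
    (h : ∀ x, -M ≤ (l • (f : C(K, ℝ)) - A f) x) (x : K) : -M ≤ l * (f : C(K, ℝ)) x := by
  have : Nonempty K := ⟨x⟩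
  obtain ⟨x₀, -, hx₀⟩ := isCompact_univ.exists_isMinOn univ_nonempty
    (f : C(K, ℝ)).continuous.continuousOn
  have hmin : ∀ x, (f : C(K, ℝ)) x₀ ≤ (f : C(K, ℝ)) x := fun x => hx₀ (mem_univ x)
  refine le_trans ?_ (mul_le_mul_of_nonneg_left (hmin x) hl.le)
  rcases le_total ((f : C(K, ℝ)) x₀) 0 with h0 | h0
  · have h1 := hA f x₀ hmin h0
    have h2 := h x₀
    simp only [ContinuousMap.sub_apply, ContinuousMap.smul_apply, smul_eq_mul] at h2
    linarith
  · have := mul_nonneg hl.le h0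
    linarith

theorem HasMinimumPrinciple.nonneg {A : C(K, ℝ) →ₗ.[ℝ] C(K, ℝ)} (hA : HasMinimumPrinciple A)
    {l : ℝ} (hl : 0 < l) (f : A.domain) (h : 0 ≤ l • (f : C(K, ℝ)) - A f) :
    0 ≤ (f : C(K, ℝ)) := by
  intro x
  have h1 := hA.le hl f le_rfl (fun x => by simpa using h x) x
  rw [neg_zero] at h1
  exact nonneg_of_mul_nonneg_right h1 hl

theorem HasMinimumPrinciple.isMDissipative {A : C(K, ℝ) →ₗ.[ℝ] C(K, ℝ)}
    (hA : HasMinimumPrinciple A)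
    (hsurj : ∀ l : ℝ, 0 < l → ∀ g : C(K, ℝ), ∃ f : A.domain, l • (f : C(K, ℝ)) - A f = g) :
    IsMDissipative A := by
  refine ⟨fun l hl f => ?_, hsurj⟩
  have key : ∀ f : A.domain, ∀ x, -‖l • (f : C(K, ℝ)) - A f‖ ≤ l * (f : C(K, ℝ)) x :=
    fun f => hA.le hl f (norm_nonneg _) fun x =>
      (abs_le.1 (ContinuousMap.norm_coe_le_norm (l • (f : C(K, ℝ)) - A f) x)).1
  rw [← Real.norm_of_nonneg hl.le, ← norm_smul, Real.norm_of_nonneg hl.le]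
  refine (ContinuousMap.norm_le _ (norm_nonneg _)).2 fun x => abs_le.2 ⟨key f x, ?_⟩
  have h := key (-f) x
  have e : l • ((-f : A.domain) : C(K, ℝ)) - A (-f) = -(l • (f : C(K, ℝ)) - A f) := by
    rw [LinearPMap.map_neg, Submodule.coe_neg, smul_neg]
    abel
  rw [e, norm_neg] at h
  simp only [Submodule.coe_neg, ContinuousMap.neg_apply, mul_neg] at h
  exact neg_le_neg_iff.1 h

theorem HasMinimumPrinciple.isFellerGenerator {A : C(K, ℝ) →ₗ.[ℝ] C(K, ℝ)}
    (hA : HasMinimumPrinciple A) (hA' : IsMDissipative A)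
    (hd : Dense (A.domain : Set C(K, ℝ))) : IsFellerGenerator A := by
  obtain ⟨T, h0, hadd, hc, hcont, hgen, hpos⟩ := hA'.exists_semigroup hd
  refine ⟨T, ⟨h0, hadd, hc, ?_, hcont⟩, hgen⟩
  have hcl : IsClosed {f : C(K, ℝ) | 0 ≤ f} := by
    have : {f : C(K, ℝ) | 0 ≤ f} = ⋂ x, {f : C(K, ℝ) | 0 ≤ f x} := by
      ext f
      simp [ContinuousMap.le_def]
    rw [this]
    exact isClosed_iInter fun x => isClosed_le continuous_const (continuous_eval_const x)
  let P : AddSubmonoid C(K, ℝ) :=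
    { carrier := {f | 0 ≤ f}
      zero_mem' := le_refl (0 : C(K, ℝ))
      add_mem' := fun {f g} (hf : 0 ≤ f) (hg : 0 ≤ g) => (add_nonneg hf hg : 0 ≤ f + g) }
  exact hpos P hcl (fun r hr f hf x => mul_nonneg hr (hf x)) fun l hl f hf => hA.nonneg hl f hf

theorem IsFellerSemigroup.isContractionSemigroup {T : ℝ≥0 → C(K, ℝ) →L[ℝ] C(K, ℝ)}
    (hT : IsFellerSemigroup T) : IsContractionSemigroup T :=
  ⟨hT.zero, hT.add, hT.contraction, hT.continuous⟩

end PositiveMinimum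

/-! ### Twice differentiable functions, Taylor's formula, one-sided minima. -/

section Calculus

/-- `G` is twice continuously differentiable on the line with derivatives `G₁` and `G₂`. -/
structure IsC2 (G G₁ G₂ : ℝ → ℝ) : Prop where
  deriv₁ : ∀ x, HasDerivAt G (G₁ x) x
  deriv₂ : ∀ x, HasDerivAt G₁ (G₂ x) x
  cont : Continuous G₂

theorem IsC2.contDiff {G G₁ G₂ : ℝ → ℝ} (h : IsC2 G G₁ G₂) : ContDiff ℝ 2 G := by
  have h1 : deriv G = G₁ := funext fun x => (h.deriv₁ x).deriv
  have h2 : deriv G₁ = G₂ := funext fun x => (h.deriv₂ x).deriv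
  have h3 : ContDiff ℝ 1 G₁ := contDiff_one_iff_deriv.2
    ⟨fun x => (h.deriv₂ x).differentiableAt, h2 ▸ h.cont⟩
  have h4 := (contDiff_succ_iff_deriv (n := 1) (f := G) (𝕜 := ℝ)).2
    ⟨fun x => (h.deriv₁ x).differentiableAt, by simp, h1 ▸ h3⟩
  simpa [one_add_one_eq_two] using h4

theorem IsC2.contDiffOn {G G₁ G₂ : ℝ → ℝ} (h : IsC2 G G₁ G₂) {p q : ℝ} {F : ℝ → ℝ}
    (hF : EqOn F G (Icc p q)) : ContDiffOn ℝ 2 F (Icc p q) :=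
  h.contDiff.contDiffOn.congr hF

theorem IsC2.d1_eq {G G₁ G₂ : ℝ → ℝ} (h : IsC2 G G₁ G₂) {p q : ℝ} (hpq : p < q) {F : ℝ → ℝ}
    (hF : EqOn F G (Icc p q)) : EqOn (d1 p q F) G₁ (Icc p q) := fun x hx => by
  rw [d1, derivWithin_congr hF (hF hx)]
  exact (h.deriv₁ x).hasDerivWithinAt.derivWithin (uniqueDiffOn_Icc hpq x hx)

theorem d2_eq_derivWithin (p q : ℝ) (F : ℝ → ℝ) (x : ℝ) :
    d2 p q F x = derivWithin (d1 p q F) (Icc p q) x := by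
  rw [d2, show (2 : ℕ) = 1 + 1 from rfl, iteratedDerivWithin_succ]
  congr 1
  ext y
  rw [iteratedDerivWithin_one, d1]

theorem IsC2.d2_eq {G G₁ G₂ : ℝ → ℝ} (h : IsC2 G G₁ G₂) {p q : ℝ} (hpq : p < q) {F : ℝ → ℝ}
    (hF : EqOn F G (Icc p q)) : EqOn (d2 p q F) G₂ (Icc p q) := fun x hx => by
  rw [d2_eq_derivWithin, derivWithin_congr (h.d1_eq hpq hF) (h.d1_eq hpq hF hx)]
  exact (h.deriv₂ x).hasDerivWithinAt.derivWithin (uniqueDiffOn_Icc hpq x hx)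

theorem IsC2.add {G G₁ G₂ H H₁ H₂ : ℝ → ℝ} (hG : IsC2 G G₁ G₂) (hH : IsC2 H H₁ H₂) :
    IsC2 (fun x => G x + H x) (fun x => G₁ x + H₁ x) (fun x => G₂ x + H₂ x) :=
  ⟨fun x => (hG.deriv₁ x).add (hH.deriv₁ x), fun x => (hG.deriv₂ x).add (hH.deriv₂ x),
    hG.cont.add hH.cont⟩

theorem IsC2.const_mul {G G₁ G₂ : ℝ → ℝ} (hG : IsC2 G G₁ G₂) (r : ℝ) :
    IsC2 (fun x => r * G x) (fun x => r * G₁ x) (fun x => r * G₂ x) :=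
  ⟨fun x => (hG.deriv₁ x).const_mul r, fun x => (hG.deriv₂ x).const_mul r,
    continuous_const.mul hG.cont⟩

theorem IsC2.comp_neg {G G₁ G₂ : ℝ → ℝ} (hG : IsC2 G G₁ G₂) :
    IsC2 (fun x => G (-x)) (fun x => -G₁ (-x)) (fun x => G₂ (-x)) := by
  refine ⟨fun x => ?_, fun x => ?_, hG.cont.comp continuous_neg⟩
  · have h : HasDerivAt (fun x => G (-x)) _ x := (hG.deriv₁ (-x)).scomp x (hasDerivAt_neg x)
    simpa using h
  · have h : HasDerivAt (fun x => -G₁ (-x)) _ x :=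
      ((hG.deriv₂ (-x)).scomp x (hasDerivAt_neg x)).neg
    simpa using h

/-- The primitive vanishing at `m`. -/
noncomputable def prim (m : ℝ) (k : ℝ → ℝ) (x : ℝ) : ℝ := ∫ y in m..x, k y

theorem hasDerivAt_prim (m : ℝ) {k : ℝ → ℝ} (hk : Continuous k) (x : ℝ) :
    HasDerivAt (prim m k) (k x) x :=
  (hk.integral_hasStrictDerivAt m x).hasDerivAt

theorem continuous_prim (m : ℝ) {k : ℝ → ℝ} (hk : Continuous k) : Continuous (prim m k) :=
  continuous_iff_continuousAt.2 fun x => (hasDerivAt_prim m hk x).continuousAt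

@[simp] theorem prim_self (m : ℝ) (k : ℝ → ℝ) : prim m k m = 0 := intervalIntegral.integral_same

theorem isC2_prim (m α p : ℝ) {k : ℝ → ℝ} (hk : Continuous k) :
    IsC2 (fun x => α + p * (x - m) + prim m (prim m k) x) (fun x => p + prim m k x) k := by
  refine ⟨fun x => ?_, fun x => (hasDerivAt_prim m hk x).const_add p, hk⟩
  have h : HasDerivAt (fun x => α + p * (x - m) + prim m (prim m k) x) _ x :=
    ((((hasDerivAt_id x).sub_const m).const_mul p).const_add α).add
      (hasDerivAt_prim m (continuous_prim m hk) x)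
  simpa using h

theorem eq_of_hasDerivWithinAt_zero {p q : ℝ} {H : ℝ → ℝ}
    (h : ∀ x ∈ Icc p q, HasDerivWithinAt H 0 (Icc p q) x) {x y : ℝ} (hx : x ∈ Icc p q)
    (hy : y ∈ Icc p q) : H x = H y := by
  have := (convex_Icc p q).norm_image_sub_le_of_norm_hasDerivWithin_le (C := 0) h
    (fun _ _ => norm_zero.le) hy hx
  rw [zero_mul, norm_le_zero_iff, sub_eq_zero] at this
  exact this

/-- Taylor's formula of order two. -/
theorem eq_taylor {p q m : ℝ} (hpq : p < q) (hm : m ∈ Icc p q) {F k : ℝ → ℝ}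
    (hF : ContDiffOn ℝ 2 F (Icc p q)) (hk : Continuous k) (hFk : EqOn (d2 p q F) k (Icc p q)) :
    EqOn F (fun x => F m + d1 p q F m * (x - m) + prim m (prim m k) x) (Icc p q) := by
  have h2 : ∀ x ∈ Icc p q, HasDerivWithinAt (d1 p q F) (k x) (Icc p q) x := by
    intro x hx
    have h3 : ContDiffOn ℝ 1 (d1 p q F) (Icc p q) :=
      hF.derivWithin (uniqueDiffOn_Icc hpq) (by norm_num)
    have h4 := (h3.differentiableOn one_ne_zero x hx).hasDerivWithinAt
    rwa [← d2_eq_derivWithin, hFk hx] at h4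
  have h1 : ∀ x ∈ Icc p q, HasDerivWithinAt F (d1 p q F x) (Icc p q) x := fun x hx =>
    (hF.differentiableOn two_ne_zero x hx).hasDerivWithinAt
  have hT := isC2_prim m (F m) (d1 p q F m) hk
  have e1 : ∀ x ∈ Icc p q, d1 p q F x - (d1 p q F m + prim m k x) = 0 := by
    intro x hx
    have := eq_of_hasDerivWithinAt_zero (fun y hy => ((h2 y hy).sub
      (hT.deriv₂ y).hasDerivWithinAt).congr_deriv (sub_self _)) hx hm
    simpa using this
  intro x hx
  rw [← sub_eq_zero]
  have := eq_of_hasDerivWithinAt_zero (fun y hy => ((h1 y hy).sub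
    (hT.deriv₁ y).hasDerivWithinAt).congr_deriv (e1 y hy)) hx hm
  simpa using this

theorem exists_isC2 {p q m : ℝ} (hpq : p < q) (hm : m ∈ Icc p q) {F : ℝ → ℝ}
    (hF : ContDiffOn ℝ 2 F (Icc p q)) :
    ∃ G G₁ G₂ : ℝ → ℝ, IsC2 G G₁ G₂ ∧ EqOn F G (Icc p q) := by
  -- Extending the second derivative by constants and integrating it twice extends `F` to a `C²`
  -- function on the line.
  let k : ℝ → ℝ := IccExtend hpq.le (fun x : Icc p q => d2 p q F x)
  have hk : Continuous k := (continuousOn_iff_continuous_domRestrict.1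
    (d2_continuousOn hpq hF)).Icc_extend'
  exact ⟨_, _, _, isC2_prim m _ _ hk, eq_taylor hpq hm hF hk fun x hx =>
    (IccExtend_of_mem hpq.le (fun x : Icc p q => d2 p q F x) hx).symm⟩

/-- The second derivative test at a one-sided minimum. -/
theorem IsC2.nonneg_of_min_right {G G₁ G₂ : ℝ → ℝ} (h : IsC2 G G₁ G₂) {p q : ℝ} (hpq : p < q)
    (hmin : ∀ x ∈ Icc p q, G p ≤ G x) (h1 : G₁ p = 0) : 0 ≤ G₂ p := by
  -- If `G₂ p < 0`, then just to the right of `p` the derivative decreases from `0`, so `G` drops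
  -- below `G p`.
  by_contra! hneg
  obtain ⟨δ, hδ, hball⟩ := Metric.eventually_nhds_iff.1
    ((h.cont.tendsto p).eventually_lt_const hneg)
  set r := min (p + δ / 2) q with hr
  have hpr : p < r := lt_min (by linarith) hpq
  have hG2 : ∀ x ∈ Icc p r, G₂ x < 0 := fun x hx => hball (by
    rw [Real.dist_eq, abs_of_nonneg (by linarith [hx.1])]
    linarith [hx.2.trans (min_le_left _ _)])
  have hG1 : StrictAntiOn G₁ (Icc p r) := strictAntiOn_of_deriv_neg (convex_Icc p r)
    (fun x _ => (h.deriv₂ x).continuousAt.continuousWithinAt) fun x hx => by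
      rw [interior_Icc] at hx
      rw [(h.deriv₂ x).deriv]
      exact hG2 x (Ioo_subset_Icc_self hx)
  have hG : StrictAntiOn G (Icc p r) := strictAntiOn_of_deriv_neg (convex_Icc p r)
    (fun x _ => (h.deriv₁ x).continuousAt.continuousWithinAt) fun x hx => by
      rw [interior_Icc] at hx
      rw [(h.deriv₁ x).deriv, ← h1]
      exact hG1 (left_mem_Icc.2 hpr.le) (Ioo_subset_Icc_self hx) hx.1
  exact absurd (hG (left_mem_Icc.2 hpr.le) (right_mem_Icc.2 hpr.le) hpr)
    (not_lt.2 (hmin r ⟨hpr.le, min_le_right _ _⟩))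

theorem IsC2.deriv_nonneg_of_min_right {G G₁ G₂ : ℝ → ℝ} (h : IsC2 G G₁ G₂) {p q : ℝ} (hpq : p < q)
    (hmin : ∀ x ∈ Icc p q, G p ≤ G x) : 0 ≤ G₁ p := by
  have h1 := (hasDerivWithinAt_iff_tendsto_slope' (s := Ioi p) (by simp)).1
    (h.deriv₁ p).hasDerivWithinAt
  refine ge_of_tendsto h1 ?_
  filter_upwards [Ioo_mem_nhdsGT hpq] with x hx
  rw [slope_def_field]
  exact div_nonneg (sub_nonneg.2 (hmin x ⟨hx.1.le, hx.2.le⟩)) (by linarith [hx.1])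

theorem IsC2.deriv_nonpos_of_min_left {G G₁ G₂ : ℝ → ℝ} (h : IsC2 G G₁ G₂) {p q : ℝ} (hpq : p < q)
    (hmin : ∀ x ∈ Icc p q, G q ≤ G x) : G₁ q ≤ 0 := by
  have := h.comp_neg.deriv_nonneg_of_min_right (neg_lt_neg hpq) fun x hx => by
    rw [neg_neg]
    exact hmin _ ⟨le_neg.1 hx.2, neg_le.1 hx.1⟩
  simpa using this

theorem IsC2.nonneg_of_min {G G₁ G₂ : ℝ → ℝ} (h : IsC2 G G₁ G₂) {p q x₀ : ℝ} (hx₀ : x₀ ∈ Ioo p q)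
    (hmin : ∀ x ∈ Icc p q, G x₀ ≤ G x) : 0 ≤ G₂ x₀ := by
  have hR : ∀ x ∈ Icc x₀ q, G x₀ ≤ G x := fun x hx => hmin x ⟨hx₀.1.le.trans hx.1, hx.2⟩
  exact h.nonneg_of_min_right hx₀.2 hR (le_antisymm
    (h.deriv_nonpos_of_min_left hx₀.1 fun x hx => hmin x ⟨hx.1, hx.2.trans hx₀.2.le⟩)
    (h.deriv_nonneg_of_min_right hx₀.2 hR))

end Calculus

/-! ### The three operators and their minimum principles. -/

section Operators

theorem onLine_apply {a b : ℝ} (h : a ≤ b) (f : C(Icc a b, ℝ)) {x : ℝ} (hx : x ∈ Icc a b) :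
    onLine h f x = f ⟨x, hx⟩ := IccExtend_of_mem h f hx

theorem continuous_onLine {a b : ℝ} (h : a ≤ b) (f : C(Icc a b, ℝ)) : Continuous (onLine h f) :=
  f.continuous.Icc_extend'

theorem IsC2.mem_stoppedBM {a b : ℝ} (h : a < b) {f : C(Icc a b, ℝ)} {G G₁ G₂ : ℝ → ℝ}
    (hG : IsC2 G G₁ G₂) (hf : ∀ x : Icc a b, f x = G x) (h1 : G₂ a = 0) (h2 : G₂ b = 0) :
    ∃ hf : f ∈ (stoppedBM h).domain, ∀ x, stoppedBM h ⟨f, hf⟩ x = 1 / 2 * G₂ x := by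
  have e : EqOn (onLine h.le f) G (Icc a b) := fun x hx => (onLine_apply h.le f hx).trans (hf _)
  have e2 := hG.d2_eq h e
  exact ⟨⟨hG.contDiffOn e, (e2 (left_mem_Icc.2 h.le)).trans h1,
    (e2 (right_mem_Icc.2 h.le)).trans h2⟩, fun x => congrArg _ (e2 x.2)⟩

theorem exists_isC2_of_mem_stoppedBM {a b : ℝ} (h : a < b) (f : (stoppedBM h).domain) :
    ∃ G G₁ G₂ : ℝ → ℝ, IsC2 G G₁ G₂ ∧ (∀ x, (f : C(Icc a b, ℝ)) x = G x) ∧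
      (∀ x, stoppedBM h f x = 1 / 2 * G₂ x) ∧ G₂ a = 0 ∧ G₂ b = 0 := by
  obtain ⟨f, hf, h1, h2⟩ := f
  obtain ⟨G, G₁, G₂, hG, e⟩ := exists_isC2 h (left_mem_Icc.2 h.le) hf
  have e2 := hG.d2_eq h e
  exact ⟨G, G₁, G₂, hG, fun x => (onLine_apply h.le f x.2).symm.trans (e x.2),
    fun x => congrArg _ (e2 x.2), (e2 (left_mem_Icc.2 h.le)).symm.trans h1,
    (e2 (right_mem_Icc.2 h.le)).symm.trans h2⟩

theorem elasticBM_apply_eq {a b : ℝ} (ha : a < 0) (hb : 0 < b) {κ : ℝ}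
    (f : (elasticBM ha hb κ).domain) (x : Icc a b) :
    elasticBM ha hb κ f x = (1 / 2) * if (x : ℝ) ≤ 0 then d2 a 0 (onLine (ha.trans hb).le f.1) x
      else d2 0 b (onLine (ha.trans hb).le f.1) x := rfl

theorem IsC2.mem_elasticBM {a b : ℝ} (ha : a < 0) (hb : 0 < b) {κ : ℝ} {f : C(Icc a b, ℝ)}
    {G G₁ G₂ H H₁ H₂ : ℝ → ℝ} (hG : IsC2 G G₁ G₂) (hH : IsC2 H H₁ H₂)
    (hfG : ∀ x : Icc a b, (x : ℝ) ≤ 0 → f x = G x) (hfH : ∀ x : Icc a b, 0 ≤ (x : ℝ) → f x = H x)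
    (h1 : G₂ a = 0) (h2 : H₂ b = 0) (h3 : H₂ 0 = G₂ 0) (h4 : H₁ 0 - G₁ 0 = κ * G 0) :
    ∃ hf : f ∈ (elasticBM ha hb κ).domain,
      (∀ x : Icc a b, (x : ℝ) ≤ 0 → elasticBM ha hb κ ⟨f, hf⟩ x = 1 / 2 * G₂ x) ∧
        ∀ x : Icc a b, 0 ≤ (x : ℝ) → elasticBM ha hb κ ⟨f, hf⟩ x = 1 / 2 * H₂ x := by
  have hab := (ha.trans hb).le
  have eG : EqOn (onLine hab f) G (Icc a 0) := fun x hx =>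
    (onLine_apply hab f ⟨hx.1, hx.2.trans hb.le⟩).trans (hfG _ hx.2)
  have eH : EqOn (onLine hab f) H (Icc 0 b) := fun x hx =>
    (onLine_apply hab f ⟨ha.le.trans hx.1, hx.2⟩).trans (hfH _ hx.1)
  have eG2 := hG.d2_eq ha eG
  have eH2 := hH.d2_eq hb eH
  have ma := left_mem_Icc.2 ha.le
  have m0 := right_mem_Icc.2 ha.le
  have m0' := left_mem_Icc.2 hb.le
  have mb := right_mem_Icc.2 hb.le
  refine ⟨⟨hG.contDiffOn eG, hH.contDiffOn eH, (eG2 ma).trans h1, (eH2 mb).trans h2, ?_, ?_⟩, ?_, ?_⟩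
  · rw [eH2 m0', eG2 m0, h3]
  · rw [hH.d1_eq hb eH m0', hG.d1_eq ha eG m0, eG m0, h4]
  · intro x hx
    rw [elasticBM_apply_eq, if_pos hx]
    exact congrArg _ (eG2 ⟨x.2.1, hx⟩)
  · intro x hx
    rw [elasticBM_apply_eq]
    refine congrArg _ ?_
    split_ifs with hx'
    · rw [le_antisymm hx' hx]
      exact (eG2 m0).trans h3.symm
    · exact eH2 ⟨hx, x.2.2⟩

/-- Both one-sided second derivatives are restrictions of one continuous function, so a single `k`
serves in Taylor's formula on either side of `0`. -/
theorem elasticBM_apply {a b : ℝ} (ha : a < 0) (hb : 0 < b) {κ : ℝ}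
    (f : (elasticBM ha hb κ).domain) :
    EqOn (d2 a 0 (onLine (ha.trans hb).le f.1))
        (onLine (ha.trans hb).le ((2 : ℝ) • elasticBM ha hb κ f)) (Icc a 0) ∧
      EqOn (d2 0 b (onLine (ha.trans hb).le f.1))
        (onLine (ha.trans hb).le ((2 : ℝ) • elasticBM ha hb κ f)) (Icc 0 b) := by
  constructor
  · intro x hx
    rw [onLine_apply _ _ ⟨hx.1, hx.2.trans hb.le⟩]
    rw [ContinuousMap.smul_apply, smul_eq_mul, elasticBM_apply_eq, if_pos hx.2]
    ring
  · intro x hx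
    rw [onLine_apply _ _ ⟨ha.le.trans hx.1, hx.2⟩]
    rw [ContinuousMap.smul_apply, smul_eq_mul, elasticBM_apply_eq]
    split_ifs with hx'
    · obtain rfl : x = 0 := le_antisymm hx' hx.1
      rw [f.2.2.2.2.2.1]
      ring
    · ring

/-- The elements of the domain of `elasticBM` by Taylor's formula at `0`. -/
theorem elasticBM_eq_taylor {a b : ℝ} (ha : a < 0) (hb : 0 < b) {κ : ℝ}
    (f : (elasticBM ha hb κ).domain) :
    ∃ (α p : ℝ) (k : ℝ → ℝ), Continuous k ∧ k a = 0 ∧ k b = 0 ∧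
      (∀ x, elasticBM ha hb κ f x = 1 / 2 * k x) ∧
      (∀ x : Icc a b, (x : ℝ) ≤ 0 → f.1 x = α + p * x + prim 0 (prim 0 k) x) ∧
      ∀ x : Icc a b, 0 ≤ (x : ℝ) → f.1 x = α + (p + κ * α) * x + prim 0 (prim 0 k) x := by
  obtain ⟨e1, e2⟩ := elasticBM_apply ha hb f
  have hab := (ha.trans hb).le
  have hk := continuous_onLine hab ((2 : ℝ) • elasticBM ha hb κ f)
  have t1 := eq_taylor ha (right_mem_Icc.2 ha.le) f.2.1 hk e1
  have t2 := eq_taylor hb (left_mem_Icc.2 hb.le) f.2.2.1 hk e2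
  refine ⟨onLine hab f.1 0, d1 a 0 (onLine hab f.1) 0, _, hk, ?_, ?_, fun x => ?_,
    fun x hx => ?_, fun x hx => ?_⟩
  · rw [← e1 (left_mem_Icc.2 ha.le)]
    exact f.2.2.2.1
  · rw [← e2 (right_mem_Icc.2 hb.le)]
    exact f.2.2.2.2.1
  · rw [onLine_apply hab _ x.2]
    rw [ContinuousMap.smul_apply, smul_eq_mul, Subtype.coe_eta]
    ring
  · have := t1 ⟨x.2.1, hx⟩
    rw [onLine_apply hab _ x.2] at this
    simpa using this
  · have := t2 ⟨hx, x.2.2⟩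
    rw [onLine_apply hab _ x.2] at this
    have h4 : d1 0 b (onLine hab f.1) 0 = _ := eq_add_of_sub_eq' f.2.2.2.2.2.2
    rw [h4] at this
    simpa using this

theorem exists_isC2_of_mem_elasticBM {a b : ℝ} (ha : a < 0) (hb : 0 < b) {κ : ℝ}
    (f : (elasticBM ha hb κ).domain) :
    ∃ G G₁ G₂ H H₁ H₂ : ℝ → ℝ, IsC2 G G₁ G₂ ∧ IsC2 H H₁ H₂ ∧
      (∀ x : Icc a b, (x : ℝ) ≤ 0 → f.1 x = G x ∧ elasticBM ha hb κ f x = 1 / 2 * G₂ x) ∧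
      (∀ x : Icc a b, 0 ≤ (x : ℝ) → f.1 x = H x ∧ elasticBM ha hb κ f x = 1 / 2 * H₂ x) ∧
      G₂ a = 0 ∧ H₂ b = 0 ∧ H₁ 0 - G₁ 0 = κ * H 0 := by
  obtain ⟨α, p, k, hk, hka, hkb, hA, hl, hr⟩ := elasticBM_eq_taylor ha hb f
  refine ⟨_, _, _, _, _, _, isC2_prim 0 α p hk, isC2_prim 0 α (p + κ * α) hk,
    fun x hx => ⟨?_, hA x⟩, fun x hx => ⟨?_, hA x⟩, hka, hkb, ?_⟩
  · simpa using hl x hx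
  · simpa using hr x hx
  · simp

theorem hasMinimumPrinciple_stoppedBM {a b : ℝ} (h : a < b) :
    HasMinimumPrinciple (stoppedBM h) := by
  intro f x₀ hmin _
  obtain ⟨G, G₁, G₂, hG, hf, hA, h1, h2⟩ := exists_isC2_of_mem_stoppedBM h f
  rw [hA]
  refine mul_nonneg (by norm_num) ?_
  rcases eq_or_lt_of_le x₀.2.1 with ha | ha
  · rw [← ha, h1]
  rcases eq_or_lt_of_le x₀.2.2 with hb | hb
  · rw [hb, h2]
  exact hG.nonneg_of_min ⟨ha, hb⟩ fun x hx => by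
    have := hmin ⟨x, hx⟩
    rwa [hf, hf] at this

theorem hasMinimumPrinciple_killedBM {a b : ℝ} (h : a < b) {q : C(ℝ, ℝ)} (hq : ∀ x, 0 ≤ q x) :
    HasMinimumPrinciple (killedBM h q) := by
  intro f x₀ hmin h0
  have h1 := hasMinimumPrinciple_stoppedBM h f x₀ hmin h0
  have h2 := mul_nonpos_of_nonneg_of_nonpos (hq x₀) h0
  change 0 ≤ stoppedBM h f x₀ - q x₀ * f.1 x₀
  linarith

theorem hasMinimumPrinciple_elasticBM {a b : ℝ} (ha : a < 0) (hb : 0 < b) {κ : ℝ} (hκ : 0 ≤ κ) :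
    HasMinimumPrinciple (elasticBM ha hb κ) := by
  intro f x₀ hmin h0
  obtain ⟨G, G₁, G₂, H, H₁, H₂, hG, hH, hfG, hfH, h1, h2, h3⟩ := exists_isC2_of_mem_elasticBM ha hb f
  have hab := (ha.trans hb).le
  have hminG : (x₀ : ℝ) ≤ 0 → ∀ x ∈ Icc a 0, G x₀ ≤ G x := fun hx₀ x hx => by
    have := hmin ⟨x, hx.1, hx.2.trans hb.le⟩
    rwa [(hfG x₀ hx₀).1, (hfG _ hx.2).1] at this
  have hminH : 0 ≤ (x₀ : ℝ) → ∀ x ∈ Icc 0 b, H x₀ ≤ H x := fun hx₀ x hx => by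
    have := hmin ⟨x, ha.le.trans hx.1, hx.2⟩
    rwa [(hfH x₀ hx₀).1, (hfH _ hx.1).1] at this
  rcases lt_trichotomy (x₀ : ℝ) 0 with hx₀ | hx₀ | hx₀
  · rw [(hfG x₀ hx₀.le).2]
    refine mul_nonneg (by norm_num) ?_
    rcases eq_or_lt_of_le x₀.2.1 with ha' | ha'
    · rw [← ha', h1]
    exact hG.nonneg_of_min ⟨ha', hx₀⟩ (hminG hx₀.le)
  · rw [(hfH x₀ hx₀.ge).2]
    refine mul_nonneg (by norm_num) ?_
    rw [(hfH x₀ hx₀.ge).1] at h0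
    have hmG := hminG hx₀.le
    have hmH := hminH hx₀.ge
    rw [hx₀] at hmG hmH h0 ⊢
    -- At the kink `G₁ 0 ≤ 0 ≤ H₁ 0`, while `H₁ 0 - G₁ 0 = κ H 0 ≤ 0`; hence `H₁ 0 = 0`.
    have i1 := hG.deriv_nonpos_of_min_left ha hmG
    have i2 := hH.deriv_nonneg_of_min_right hb hmH
    have i3 := mul_nonpos_of_nonneg_of_nonpos hκ h0
    exact hH.nonneg_of_min_right hb hmH (by linarith)
  · rw [(hfH x₀ hx₀.le).2]
    refine mul_nonneg (by norm_num) ?_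
    rcases eq_or_lt_of_le x₀.2.2 with hb' | hb'
    · rw [hb', h2]
    exact hH.nonneg_of_min ⟨hx₀, hb'⟩ (hminH hx₀.le)

end Operators

/-! ### Solving the resolvent equations. -/

section Resolvents

theorem exists_sub_eq_of_norm_lt_one {E : Type*} [NormedAddCommGroup E] [NormedSpace ℝ E]
    [CompleteSpace E] {W : E →L[ℝ] E} (hW : ‖W‖ < 1) (g : E) : ∃ u, u - W u = g := by
  obtain ⟨V, hV⟩ := isUnit_one_sub_of_norm_lt_one hW
  refine ⟨(↑V⁻¹ : E →L[ℝ] E) g, ?_⟩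
  have h1 := congrArg (fun L : E →L[ℝ] E => L g) V.mul_inv
  rw [hV] at h1
  exact h1

theorem isC2_cosh (ω : ℝ) : IsC2 (fun x => Real.cosh (ω * x)) (fun x => ω * Real.sinh (ω * x))
    (fun x => ω ^ 2 * Real.cosh (ω * x)) := by
  have hm : ∀ x, HasDerivAt (fun x => ω * x) ω x := fun x => by
    simpa using (hasDerivAt_id x).const_mul ω
  refine ⟨fun x => ?_, fun x => ?_, by fun_prop⟩
  · exact (hm x).cosh.congr_deriv (by ring)
  · exact ((hm x).sinh.const_mul ω).congr_deriv (by ring)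

theorem isC2_sinh (ω : ℝ) : IsC2 (fun x => Real.sinh (ω * x)) (fun x => ω * Real.cosh (ω * x))
    (fun x => ω ^ 2 * Real.sinh (ω * x)) := by
  have hm : ∀ x, HasDerivAt (fun x => ω * x) ω x := fun x => by
    simpa using (hasDerivAt_id x).const_mul ω
  refine ⟨fun x => ?_, fun x => ?_, by fun_prop⟩
  · exact (hm x).sinh.congr_deriv (by ring)
  · exact ((hm x).cosh.const_mul ω).congr_deriv (by ring)

/-- Variation of constants: a solution of `P'' = ω² P - 2 g` with vanishing initial values. -/
theorem exists_particular_solution {ω : ℝ} (hω : ω ≠ 0) {g : ℝ → ℝ} (hg : Continuous g) :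
    ∃ P P₁ : ℝ → ℝ, IsC2 P P₁ (fun x => ω ^ 2 * P x - 2 * g x) ∧ P 0 = 0 ∧ P₁ 0 = 0 := by
  set C := prim 0 fun x => Real.cosh (ω * x) * g x with hC
  set S := prim 0 fun x => Real.sinh (ω * x) * g x with hS
  have hC' : ∀ x, HasDerivAt C (Real.cosh (ω * x) * g x) x :=
    hasDerivAt_prim 0 (by fun_prop)
  have hS' : ∀ x, HasDerivAt S (Real.sinh (ω * x) * g x) x :=
    hasDerivAt_prim 0 (by fun_prop)
  have hCc : Continuous C := continuous_prim 0 (by fun_prop)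
  have hSc : Continuous S := continuous_prim 0 (by fun_prop)
  have hch := fun x => (isC2_cosh ω).deriv₁ x
  have hsh := fun x => (isC2_sinh ω).deriv₁ x
  refine ⟨fun x => -(2 / ω) * (Real.sinh (ω * x) * C x - Real.cosh (ω * x) * S x),
    fun x => -2 * (Real.cosh (ω * x) * C x - Real.sinh (ω * x) * S x),
    ⟨fun x => ?_, fun x => ?_, by fun_prop⟩, by simp [hC, hS], by simp [hC, hS]⟩
  · refine ((((hsh x).mul (hC' x)).sub ((hch x).mul (hS' x))).const_mul (-(2 / ω))).congr_deriv ?_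
    field_simp
    ring
  · refine ((((hch x).mul (hC' x)).sub ((hsh x).mul (hS' x))).const_mul (-2)).congr_deriv ?_
    have := Real.cosh_sq' (ω * x)
    field_simp
    linear_combination (-g x) * this

/-- The determinant is positive because `sinh (ω a) < 0 < sinh (ω b)` and `κ ≥ 0`. -/
theorem exists_boundary_solution {a b ω κ : ℝ} (ha : a < 0) (hb : 0 < b) (hω : 0 < ω) (hκ : 0 ≤ κ)
    (r s : ℝ) : ∃ α β : ℝ, α * Real.cosh (ω * a) + β * Real.sinh (ω * a) = r ∧
      α * (Real.cosh (ω * b) + κ / ω * Real.sinh (ω * b)) + β * Real.sinh (ω * b) = s := by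
  have h1 : Real.sinh (ω * a) < 0 := Real.sinh_neg_iff.2 (mul_neg_of_pos_of_neg hω ha)
  have h2 : 0 < Real.sinh (ω * b) := Real.sinh_pos_iff.2 (mul_pos hω hb)
  have h3 := Real.cosh_pos (ω * a)
  have h4 := Real.cosh_pos (ω * b)
  set A := Real.cosh (ω * b) + κ / ω * Real.sinh (ω * b) with hA
  have h5 : 0 < A := by positivity
  have hD : 0 < Real.cosh (ω * a) * Real.sinh (ω * b) - Real.sinh (ω * a) * A := by
    have := mul_pos h3 h2
    have := mul_neg_of_neg_of_pos h1 h5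
    linarith
  set D := Real.cosh (ω * a) * Real.sinh (ω * b) - Real.sinh (ω * a) * A with hDd
  refine ⟨(r * Real.sinh (ω * b) - s * Real.sinh (ω * a)) / D,
    (s * Real.cosh (ω * a) - r * A) / D, ?_, ?_⟩
  · field_simp
    rw [hDd]
    ring
  · field_simp
    rw [hDd]
    ring

/-- With `ω² = 2 l`, both branches are a particular solution plus hyperbolic functions; the right
one carries an extra multiple of `sinh (ω x)`, which vanishes at `0` and creates exactly the
required jump of the derivative. The condition `f'' = 0` at an end becomes `l f = g` there. The
factor `κ` is kept visible so that `κ = 0` makes the branches coincide, which serves `stoppedBM`. -/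
theorem exists_elasticBM_resolvent {a b : ℝ} (ha : a < 0) (hb : 0 < b) {κ : ℝ} (hκ : 0 ≤ κ) {l : ℝ}
    (hl : 0 < l) (g : C(Icc a b, ℝ)) : ∃ (α : ℝ) (G G₁ H H₁ : ℝ → ℝ),
      IsC2 G G₁ (fun x => 2 * l * G x - 2 * onLine (ha.trans hb).le g x) ∧
      IsC2 H H₁ (fun x => 2 * l * H x - 2 * onLine (ha.trans hb).le g x) ∧
      G 0 = H 0 ∧ H₁ 0 - G₁ 0 = κ * G 0 ∧ l * G a = onLine (ha.trans hb).le g a ∧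
      l * H b = onLine (ha.trans hb).le g b ∧ ∀ x, H x = G x + κ * (α * Real.sinh (√(2 * l) * x)) := by
  set g' := onLine (ha.trans hb).le g
  set ω := √(2 * l) with hω
  have hω0 : 0 < ω := by positivity
  have hω2 : ω ^ 2 = 2 * l := Real.sq_sqrt (by positivity)
  obtain ⟨P, P₁, hP, hP0, hP10⟩ :=
    exists_particular_solution hω0.ne' (continuous_onLine (ha.trans hb).le g)
  obtain ⟨α, β, h1, h2⟩ := exists_boundary_solution ha hb hω0 hκ (g' a / l - P a) (g' b / l - P b)
  have hG := (hP.add ((isC2_cosh ω).const_mul α)).add ((isC2_sinh ω).const_mul β)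
  have hH := hG.add ((isC2_sinh ω).const_mul (κ * (α / ω)))
  refine ⟨α / ω, _, _, _, _, ⟨hG.deriv₁, fun x => (hG.deriv₂ x).congr_deriv ?_, ?_⟩,
    ⟨hH.deriv₁, fun x => (hH.deriv₂ x).congr_deriv ?_, ?_⟩, ?_, ?_, ?_, ?_, ?_⟩
  · rw [hω2]; ring
  · have : Continuous g' := continuous_onLine _ _
    have : Continuous P := continuous_iff_continuousAt.2 fun x => (hP.deriv₁ x).continuousAt
    fun_prop
  · rw [hω2]; ring
  · have : Continuous g' := continuous_onLine _ _
    have : Continuous P := continuous_iff_continuousAt.2 fun x => (hP.deriv₁ x).continuousAt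
    fun_prop
  · simp
  · simp [hP0]
    field_simp
  · have : P a + α * Real.cosh (ω * a) + β * Real.sinh (ω * a) = g' a / l := by linarith
    rw [this]
    field_simp
  · have : P b + α * Real.cosh (ω * b) + β * Real.sinh (ω * b) +
        κ * (α / ω) * Real.sinh (ω * b) = g' b / l := by
      have e : α * (Real.cosh (ω * b) + κ / ω * Real.sinh (ω * b)) =
        α * Real.cosh (ω * b) + κ * (α / ω) * Real.sinh (ω * b) := by ring
      linarith
    rw [this]
    field_simp
  · intro x
    ring

theorem isMDissipative_elasticBM {a b : ℝ} (ha : a < 0) (hb : 0 < b) {κ : ℝ} (hκ : 0 ≤ κ) :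
    IsMDissipative (elasticBM ha hb κ) := by
  refine (hasMinimumPrinciple_elasticBM ha hb hκ).isMDissipative fun l hl g => ?_
  obtain ⟨α, G, G₁, H, H₁, hG, hH, h0, h1, h2, h3, hGH⟩ :=
    exists_elasticBM_resolvent ha hb hκ hl g
  have hGc : Continuous G := continuous_iff_continuousAt.2 fun x => (hG.deriv₁ x).continuousAt
  let f : C(Icc a b, ℝ) :=
    ⟨fun x => G x + κ * (α * Real.sinh (√(2 * l) * max (x : ℝ) 0)), by fun_prop⟩
  have hfG : ∀ x : Icc a b, (x : ℝ) ≤ 0 → f x = G x := fun x hx => by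
    simp [f, max_eq_right hx]
  have hfH : ∀ x : Icc a b, 0 ≤ (x : ℝ) → f x = H x := fun x hx => by
    simp [f, max_eq_left hx, hGH]
  obtain ⟨hf, hl', hr⟩ := hG.mem_elasticBM ha hb hH hfG hfH (by linarith) (by linarith)
    (by rw [h0]) h1
  refine ⟨⟨f, hf⟩, ?_⟩
  ext x
  rw [ContinuousMap.sub_apply, ContinuousMap.smul_apply, smul_eq_mul]
  have hg := onLine_apply (ha.trans hb).le g x.2
  rcases le_total (x : ℝ) 0 with hx | hx
  · rw [hl' x hx, hfG x hx, hg]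
    ring
  · rw [hr x hx, hfH x hx, hg]
    ring

theorem isMDissipative_stoppedBM {a b : ℝ} (ha : a < 0) (hb : 0 < b) :
    IsMDissipative (stoppedBM (ha.trans hb)) := by
  refine (hasMinimumPrinciple_stoppedBM _).isMDissipative fun l hl g => ?_
  obtain ⟨α, G, G₁, H, H₁, hG, hH, h0, h1, h2, h3, hGH⟩ :=
    exists_elasticBM_resolvent ha hb le_rfl hl g
  simp only [zero_mul, add_zero] at hGH
  have hGc : Continuous G := continuous_iff_continuousAt.2 fun x => (hG.deriv₁ x).continuousAt
  let f : C(Icc a b, ℝ) := ⟨fun x => G x, by fun_prop⟩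
  obtain ⟨hf, hA⟩ := hG.mem_stoppedBM (ha.trans hb) (f := f) (fun x => rfl) (by linarith)
    (by rw [hGH] at h3; linarith)
  refine ⟨⟨f, hf⟩, ?_⟩
  ext x
  rw [ContinuousMap.sub_apply, ContinuousMap.smul_apply, smul_eq_mul, hA,
    onLine_apply (ha.trans hb).le g x.2]
  change l * G x - _ = _
  ring

theorem isMDissipative_killedBM {a b : ℝ} (ha : a < 0) (hb : 0 < b) {q : C(ℝ, ℝ)}
    (hq : ∀ x, 0 ≤ q x) : IsMDissipative (killedBM (ha.trans hb) q) := by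
  refine (hasMinimumPrinciple_killedBM _ hq).isMDissipative fun l hl g => ?_
  let Q : C(Icc a b, ℝ) := q.restrict (Icc a b)
  have hlM : 0 < l + ‖Q‖ := by positivity
  obtain ⟨R, hR⟩ := (isMDissipative_stoppedBM ha hb).exists_resolvent hlM
  -- `l - A₀ + q = (l + ‖Q‖ - A₀) - (‖Q‖ - q)`. Since `0 ≤ Q ≤ ‖Q‖`, the perturbation composed with
  -- `R` has norm at most `‖Q‖ / (l + ‖Q‖) < 1`.
  let P : C(Icc a b, ℝ) := ContinuousMap.const _ ‖Q‖ - Q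
  have hP : ‖P‖ ≤ ‖Q‖ := (ContinuousMap.norm_le _ (norm_nonneg _)).2 fun x => by
    have h1 : Q x ≤ ‖Q‖ := (le_abs_self _).trans (Q.norm_coe_le_norm x)
    have h2 : 0 ≤ Q x := hq x
    rw [Real.norm_eq_abs, abs_le]
    change -‖Q‖ ≤ ‖Q‖ - Q x ∧ ‖Q‖ - Q x ≤ ‖Q‖
    constructor <;> linarith
  let W : C(Icc a b, ℝ) →L[ℝ] C(Icc a b, ℝ) := (ContinuousLinearMap.mul ℝ C(Icc a b, ℝ) P).comp R
  have hW : ‖W‖ < 1 := by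
    have h1 : ‖W‖ ≤ ‖Q‖ / (l + ‖Q‖) := by
      refine ContinuousLinearMap.opNorm_le_bound _ (by positivity) fun u => ?_
      have h2 := hR.bound u
      rw [← le_div_iff₀' hlM] at h2
      calc ‖P * R u‖ ≤ ‖P‖ * ‖R u‖ := norm_mul_le _ _
        _ ≤ ‖Q‖ * (‖u‖ / (l + ‖Q‖)) := by gcongr
        _ = _ := by ring
    refine h1.trans_lt ?_
    rw [div_lt_one hlM]
    linarith
  obtain ⟨u, hu⟩ : ∃ u, u - P * R u = g := exists_sub_eq_of_norm_lt_one hW g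
  obtain ⟨hf, h⟩ := hR.right_inv u
  refine ⟨⟨R u, hf⟩, ?_⟩
  rw [← hu]
  nth_rewrite 3 [← h]
  ext x
  change l * R u x - (stoppedBM _ ⟨R u, hf⟩ x - Q x * R u x) =
    (l + ‖Q‖) * R u x - stoppedBM _ ⟨R u, hf⟩ x - (‖Q‖ - Q x) * R u x
  ring

end Resolvents

/-! ### Density of the domains. -/

section Density

theorem isC2_affine (α p : ℝ) : IsC2 (fun x => α + p * x) (fun _ => p) (fun _ => 0) :=
  ⟨fun x => by simpa using ((hasDerivAt_id x).const_mul p).const_add α,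
    fun x => hasDerivAt_const x p, continuous_const⟩

theorem IsC2.mul {G G₁ G₂ H H₁ H₂ : ℝ → ℝ} (hG : IsC2 G G₁ G₂) (hH : IsC2 H H₁ H₂) :
    IsC2 (fun x => G x * H x) (fun x => G₁ x * H x + G x * H₁ x)
      (fun x => G₂ x * H x + 2 * (G₁ x * H₁ x) + G x * H₂ x) := by
  have c0 : ∀ {G G₁ G₂ : ℝ → ℝ}, IsC2 G G₁ G₂ → Continuous G := fun h =>
    continuous_iff_continuousAt.2 fun x => (h.deriv₁ x).continuousAt
  have c1 : ∀ {G G₁ G₂ : ℝ → ℝ}, IsC2 G G₁ G₂ → Continuous G₁ := fun h =>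
    continuous_iff_continuousAt.2 fun x => (h.deriv₂ x).continuousAt
  refine ⟨fun x => (hG.deriv₁ x).mul (hH.deriv₁ x), fun x => ?_, ?_⟩
  · refine (((hG.deriv₂ x).mul (hH.deriv₁ x)).add ((hG.deriv₁ x).mul (hH.deriv₂ x))).congr_deriv ?_
    ring
  · have := c0 hG
    have := c1 hG
    have := c0 hH
    have := c1 hH
    have := hG.cont
    have := hH.cont
    fun_prop

/-- The twice continuously differentiable functions on `[a, b]` whose first two derivatives vanish
on the set `Z`. -/
def flatSubalgebra (a b : ℝ) (Z : Set ℝ) : Subalgebra ℝ C(Icc a b, ℝ) where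
  carrier := {f | ∃ G G₁ G₂ : ℝ → ℝ, IsC2 G G₁ G₂ ∧ (∀ x, f x = G x) ∧ ∀ z ∈ Z, G₁ z = 0 ∧ G₂ z = 0}
  mul_mem' := by
    rintro f g ⟨G, G₁, G₂, hG, hf, hGz⟩ ⟨H, H₁, H₂, hH, hg, hHz⟩
    refine ⟨_, _, _, hG.mul hH, fun x => ?_, fun z hz => ?_⟩
    · rw [ContinuousMap.mul_apply, hf, hg]
    · simp [hGz z hz, hHz z hz]
  add_mem' := by
    rintro f g ⟨G, G₁, G₂, hG, hf, hGz⟩ ⟨H, H₁, H₂, hH, hg, hHz⟩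
    refine ⟨_, _, _, hG.add hH, fun x => ?_, fun z hz => ?_⟩
    · rw [ContinuousMap.add_apply, hf, hg]
    · simp [hGz z hz, hHz z hz]
  algebraMap_mem' := fun r => ⟨_, _, _, isC2_affine r 0, fun x => by simp [algebraMap_apply],
    fun z _ => ⟨rfl, rfl⟩⟩

/-- A primitive of `(t (t - a) (t - b))²` is strictly increasing, and the square makes its first two
derivatives vanish at all three points. -/
theorem flatSubalgebra_separatesPoints (a b : ℝ) :
    (flatSubalgebra a b {a, 0, b}).SeparatesPoints := by
  let w : ℝ → ℝ := fun t => (t * (t - a) * (t - b)) ^ 2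
  have hw : Continuous w := by fun_prop
  have hd : ∀ t, HasDerivAt w
      (2 * (t * (t - a) * (t - b)) * ((t - a) * (t - b) + t * (t - b) + t * (t - a))) t := by
    intro t
    have h := ((((hasDerivAt_id t).mul ((hasDerivAt_id t).sub_const a)).mul
      ((hasDerivAt_id t).sub_const b)).pow 2)
    refine HasDerivAt.congr_deriv (f := w) h ?_
    change ((2 : ℕ) : ℝ) * (t * (t - a) * (t - b)) ^ 1 *
      ((1 * (t - a) + t * 1) * (t - b) + t * (t - a) * 1) = _
    push_cast
    ring
  have hC2 : IsC2 (prim 0 w) w _ := ⟨hasDerivAt_prim 0 hw, hd, by fun_prop⟩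
  have hlt : ∀ x y : ℝ, x < y → prim 0 w x < prim 0 w y := by
    intro x y hxy
    have hi : ∀ u v, IntervalIntegrable w MeasureTheory.volume u v := fun u v =>
      hw.intervalIntegrable u v
    rw [← sub_pos, prim, prim, intervalIntegral.integral_interval_sub_left (hi _ _) (hi _ _)]
    refine intervalIntegral.integral_pos hxy hw.continuousOn (fun t _ => sq_nonneg _) ?_
    obtain ⟨t, ht, ht'⟩ := ((Ioo_infinite hxy).sdiff (toFinite ({a, 0, b} : Set ℝ))).nonempty
    simp only [mem_insert_iff, mem_singleton_iff, not_or] at ht'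
    refine ⟨t, Ioo_subset_Icc_self ht, ?_⟩
    have h1 := sub_ne_zero.2 ht'.1
    have h2 := sub_ne_zero.2 ht'.2.2
    have h3 := ht'.2.1
    positivity
  intro x y hxy
  refine ⟨_, ⟨⟨fun x => prim 0 w x, (continuous_prim 0 hw).comp continuous_subtype_val⟩,
    ⟨_, _, _, hC2, fun x => rfl, ?_⟩, rfl⟩, ?_⟩
  · rintro z (rfl | rfl | rfl) <;> simp [w]
  · rcases lt_or_gt_of_ne (Subtype.coe_ne_coe.2 hxy) with h | h
    · exact (hlt _ _ h).ne
    · exact (hlt _ _ h).ne'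

theorem dense_flatSubalgebra (a b : ℝ) :
    Dense (flatSubalgebra a b {a, 0, b} : Set C(Icc a b, ℝ)) := by
  have h := ContinuousMap.subalgebra_topologicalClosure_eq_top_of_separatesPoints _
    (flatSubalgebra_separatesPoints a b)
  rw [dense_iff_closure_eq, ← Subalgebra.topologicalClosure_coe, h]
  rfl

theorem dense_stoppedBM {a b : ℝ} (h : a < b) :
    Dense ((stoppedBM h).domain : Set C(Icc a b, ℝ)) := by
  refine (dense_flatSubalgebra a b).mono ?_
  rintro f ⟨G, G₁, G₂, hG, hf, hz⟩
  exact (hG.mem_stoppedBM h hf (hz a (by simp)).2 (hz b (by simp)).2).1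

/-- Flat functions satisfy the jump condition once they vanish at `0`, so `Φ f = f - f(0)` always
lies in the closure of the domain. Constants are recovered from `e`, an element of the domain with
`e(0) = 1`, because `e - Φ e = 1`. -/
theorem dense_elasticBM {a b : ℝ} (ha : a < 0) (hb : 0 < b) (κ : ℝ) :
    Dense ((elasticBM ha hb κ).domain : Set C(Icc a b, ℝ)) := by
  let o : Icc a b := ⟨0, ha.le, hb.le⟩
  let Φ : C(Icc a b, ℝ) → C(Icc a b, ℝ) := fun f => f - f o • (1 : C(Icc a b, ℝ))
  have hΦc : Continuous Φ := by
    have h1 : Continuous fun f : C(Icc a b, ℝ) => f o := continuous_eval_const o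
    fun_prop
  have hΦ : ∀ f, Φ f ∈ (elasticBM ha hb κ).domain.topologicalClosure := by
    intro f
    refine map_mem_closure hΦc (dense_flatSubalgebra a b f) ?_
    rintro g ⟨G, G₁, G₂, hG, hg, hz⟩
    have hG' := hG.add (isC2_affine (-G 0) 0)
    have e : ∀ x : Icc a b, Φ g x = G x + (-G 0 + 0 * x) := fun x => by
      simp [Φ, hg, o, sub_eq_add_neg]
    exact (hG'.mem_elasticBM ha hb hG' (fun x _ => e x) (fun x _ => e x)
      (by simp [hz a]) (by simp [hz b]) rfl (by simp)).1
  let e : C(Icc a b, ℝ) := ⟨fun x => 1 + κ * max (x : ℝ) 0, by fun_prop⟩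
  have he : e ∈ (elasticBM ha hb κ).domain.topologicalClosure :=
    subset_closure ((isC2_affine 1 0).mem_elasticBM ha hb (isC2_affine 1 κ)
      (fun x hx => by simp [e, max_eq_right hx]) (fun x hx => by simp [e, max_eq_left hx])
      rfl rfl rfl (by simp)).1
  intro f
  have hfe : f = Φ f + f o • (e - Φ e) := by
    ext x
    simp [Φ, e, o]
  rw [hfe]
  exact Submodule.add_mem _ (hΦ f) (Submodule.smul_mem _ _ (Submodule.sub_mem _ he (hΦ e)))

theorem isFellerGenerator_elasticBM {a b : ℝ} (ha : a < 0) (hb : 0 < b) {κ : ℝ} (hκ : 0 ≤ κ) :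
    IsFellerGenerator (elasticBM ha hb κ) :=
  (hasMinimumPrinciple_elasticBM ha hb hκ).isFellerGenerator (isMDissipative_elasticBM ha hb hκ)
    (dense_elasticBM ha hb κ)

theorem isFellerGenerator_killedBM {a b : ℝ} (ha : a < 0) (hb : 0 < b) {q : C(ℝ, ℝ)}
    (hq : ∀ x, 0 ≤ q x) : IsFellerGenerator (killedBM (ha.trans hb) q) :=
  (hasMinimumPrinciple_killedBM _ hq).isFellerGenerator (isMDissipative_killedBM ha hb hq)
    (dense_stoppedBM (ha.trans hb))

end Density

/-! ### Approximate solutions for a general killing rate. -/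

section Approximation

open MeasureTheory

theorem prim_add_mul {m : ℝ} {f g : ℝ → ℝ} (hf : Continuous f) (hg : Continuous g) (r x : ℝ) :
    prim m (fun y => f y + r * g y) x = prim m f x + r * prim m g x := by
  have hg' : Continuous fun y => r * g y := by fun_prop
  rw [prim, intervalIntegral.integral_add (hf.intervalIntegrable _ _)
    (hg'.intervalIntegrable _ _), intervalIntegral.integral_const_mul]
  rfl

theorem prim_prim_add_mul {m : ℝ} {f g : ℝ → ℝ} (hf : Continuous f) (hg : Continuous g) (r x : ℝ) :
    prim m (prim m fun y => f y + r * g y) x = prim m (prim m f) x + r * prim m (prim m g) x := by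
  rw [← prim_add_mul (continuous_prim m hf) (continuous_prim m hg)]
  congr 1
  ext y
  exact prim_add_mul hf hg r y

theorem abs_prim_le {a b : ℝ} (ha : a < 0) (hb : 0 < b) {h : ℝ → ℝ} (hh : Continuous h) {x : ℝ}
    (hx : x ∈ Icc a b) : |prim 0 h x| ≤ ∫ y in a..b, |h y| := by
  have hsub : uIoc 0 x ⊆ Ioc a b := by
    rw [uIoc]
    exact Ioc_subset_Ioc (le_min ha.le hx.1) (max_le hb.le hx.2)
  rw [intervalIntegral.integral_of_le (ha.trans hb).le, ← Real.norm_eq_abs]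
  refine (intervalIntegral.norm_integral_le_integral_norm_uIoc).trans ?_
  refine setIntegral_mono_set ?_ (Eventually.of_forall fun y => abs_nonneg _) hsub.eventuallyLE
  exact hh.abs.integrableOn_Ioc

/-- The factor `|x|` is what later absorbs the concentration of `q` near `0`, through the bound on
`|x| q x`. -/
theorem abs_prim_le_mul {a b : ℝ} (ha : a < 0) (hb : 0 < b) {h : ℝ → ℝ} {M : ℝ}
    (hM : ∀ y ∈ Icc a b, |h y| ≤ M) {x : ℝ} (hx : x ∈ Icc a b) : |prim 0 h x| ≤ M * |x| := by
  have hsub : uIoc 0 x ⊆ Icc a b := by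
    rw [uIoc]
    exact (Ioc_subset_Ioc (le_min ha.le hx.1) (max_le hb.le hx.2)).trans Ioc_subset_Icc_self
  have := intervalIntegral.norm_integral_le_of_norm_le_const (a := 0) (b := x) (f := h) (C := M)
    fun y hy => hM y (hsub hy)
  rwa [sub_zero] at this

/-- For a killing rate `q`, an element of the domain of `killedBM` that is close to
`x ↦ α + s x + ∫₀ˣ∫₀ʸ (k + 2 α q)`, with image close to `k / 2`. -/
theorem exists_mem_killedBM_close {a b : ℝ} (ha : a < 0) (hb : 0 < b) {q : C(ℝ, ℝ)}
    (hq : ∀ x, 0 ≤ q x) {γ C : ℝ} (hγ : ∀ y ∈ Icc a b, |prim 0 q y| ≤ γ)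
    (hC : ∀ y ∈ Icc a b, |y| * q y ≤ C) (α s : ℝ) {k : ℝ → ℝ} (hk : Continuous k) (hka : k a = 0)
    (hkb : k b = 0) {M N ρ : ℝ} (hM : M = |s| + (∫ y in a..b, |k y|) + 2 * |α| * γ)
    (hN : N = |α| + M * (b - a))
    (hρ : ρ = 2 * M * (∫ y in a..b, |y| * q y) + (b - a) * (2 * (q a + q b) * N)) :
    ∃ F : (killedBM (ha.trans hb) q).domain,
      (∀ x : Icc a b, |F.1 x - (α + s * x + (prim 0 (prim 0 k) x + 2 * α * prim 0 (prim 0 q) x))|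
        ≤ (b - a) * ρ) ∧
      ∀ x : Icc a b, |killedBM (ha.trans hb) q F x - 1 / 2 * k x| ≤ C * ρ + (q a + q b) * N := by
  have hab : 0 < b - a := by linarith
  have hqc : Continuous q := q.continuous
  have hxab : ∀ x ∈ Icc a b, |x| ≤ b - a := fun x hx => by
    rw [abs_le]
    constructor <;> linarith [hx.1, hx.2]
  have hγ0 : 0 ≤ γ := (abs_nonneg _).trans (hγ 0 ⟨ha.le, hb.le⟩)
  have hC0 : 0 ≤ C := (mul_nonneg (abs_nonneg 0) (hq 0)).trans (hC 0 ⟨ha.le, hb.le⟩)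
  have hM0 : 0 ≤ M := by
    have : 0 ≤ ∫ y in a..b, |k y| :=
      intervalIntegral.integral_nonneg (ha.trans hb).le fun _ _ => abs_nonneg _
    rw [hM]
    positivity
  have hN0 : 0 ≤ N := by rw [hN]; positivity
  set k₁ : ℝ → ℝ := fun y => k y + 2 * α * q y with hk₁
  have hk₁c : Continuous k₁ := by fun_prop
  set F₁ : ℝ → ℝ := fun x => α + s * (x - 0) + prim 0 (prim 0 k₁) x with hF₁
  have hF₁C2 : IsC2 F₁ _ k₁ := isC2_prim 0 α s hk₁c
  have hF₁c : Continuous F₁ := continuous_iff_continuousAt.2 fun x => (hF₁C2.deriv₁ x).continuousAt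
  -- The constant `M` depends on `q` only through the bound `γ` on its primitive, so it stays fixed
  -- as the rate concentrates.
  have hF₁α : ∀ x ∈ Icc a b, |F₁ x - α| ≤ M * |x| := by
    intro x hx
    have h1 : |prim 0 (prim 0 k₁) x| ≤ ((∫ y in a..b, |k y|) + 2 * |α| * γ) * |x| := by
      refine abs_prim_le_mul ha hb (fun y hy => ?_) hx
      rw [hk₁, prim_add_mul hk hqc]
      refine (abs_add_le _ _).trans (add_le_add (abs_prim_le ha hb hk hy) ?_)
      rw [abs_mul, abs_mul, abs_two]
      gcongr
      exact hγ y hy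
    have e : F₁ x - α = s * x + prim 0 (prim 0 k₁) x := by simp only [hF₁]; ring
    rw [e]
    refine (abs_add_le _ _).trans ?_
    rw [abs_mul, hM]
    linarith
  have hF₁N : ∀ x ∈ Icc a b, |F₁ x| ≤ N := by
    intro x hx
    have h1 := (hF₁α x hx).trans (mul_le_mul_of_nonneg_left (hxab x hx) hM0)
    have h2 := abs_add_le (F₁ x - α) α
    rw [sub_add_cancel] at h2
    linarith
  set L : ℝ := 2 * (q a + q b) * N with hL
  -- The affine interpolation of `-2 q F₁` at the two ends, which cancels the second derivative
  -- there.
  set ℓ : ℝ → ℝ := fun x => -(2 * (q a * F₁ a)) * ((b - x) / (b - a)) -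
    2 * (q b * F₁ b) * ((x - a) / (b - a)) with hℓ
  have hℓc : Continuous ℓ := by fun_prop
  have hℓL : ∀ x ∈ Icc a b, |ℓ x| ≤ L := by
    intro x hx
    have h1 : |(b - x) / (b - a)| ≤ 1 := by
      rw [abs_div, abs_of_pos hab, div_le_one hab, abs_le]
      constructor <;> linarith [hx.1, hx.2]
    have h2 : |(x - a) / (b - a)| ≤ 1 := by
      rw [abs_div, abs_of_pos hab, div_le_one hab, abs_le]
      constructor <;> linarith [hx.1, hx.2]
    have h3 : ∀ z ∈ Icc a b, |2 * (q z * F₁ z)| ≤ 2 * (q z * N) := fun z hz => by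
      rw [abs_mul, abs_mul, abs_two, abs_of_nonneg (hq z)]
      exact mul_le_mul_of_nonneg_left (mul_le_mul_of_nonneg_left (hF₁N z hz) (hq z)) two_pos.le
    have h4 := h3 a ⟨le_rfl, (ha.trans hb).le⟩
    have h5 := h3 b ⟨(ha.trans hb).le, le_rfl⟩
    refine (abs_sub _ _).trans ?_
    rw [abs_mul, abs_mul (2 * (q b * F₁ b)), abs_neg]
    have h6 := mul_le_of_le_one_right (abs_nonneg (2 * (q a * F₁ a))) h1
    have h7 := mul_le_of_le_one_right (abs_nonneg (2 * (q b * F₁ b))) h2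
    rw [hL]
    linarith
  set h : ℝ → ℝ := fun y => 2 * (q y * (F₁ y - α)) + ℓ y with hh
  have hhc : Continuous h := by fun_prop
  have hhρ : ∫ y in a..b, |h y| ≤ ρ := by
    have hi : ∫ y in a..b, (2 * M * (|y| * q y) + L) = ρ := by
      rw [intervalIntegral.integral_add (Continuous.intervalIntegrable (by fun_prop) _ _)
        (Continuous.intervalIntegrable (by fun_prop) _ _), intervalIntegral.integral_const_mul,
        intervalIntegral.integral_const, smul_eq_mul, hρ]
    rw [← hi]
    refine intervalIntegral.integral_mono_on (ha.trans hb).le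
      (Continuous.intervalIntegrable (by fun_prop) _ _)
      (Continuous.intervalIntegrable (by fun_prop) _ _) fun y hy => ?_
    refine (abs_add_le _ _).trans (add_le_add ?_ (hℓL y hy))
    rw [abs_mul, abs_mul, abs_two, abs_of_nonneg (hq y)]
    have := mul_le_mul_of_nonneg_left (hF₁α y hy) (hq y)
    linarith
  have hρ0 : 0 ≤ ρ := le_trans
    (intervalIntegral.integral_nonneg (ha.trans hb).le fun _ _ => abs_nonneg _) hhρ
  have hhx : ∀ x ∈ Icc a b, |prim 0 (prim 0 h) x| ≤ ρ * |x| := fun x hx =>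
    abs_prim_le_mul ha hb (fun y hy => (abs_prim_le ha hb hhc hy).trans hhρ) hx
  -- The factor `1` puts the sum in the shape of `prim_prim_add_mul`.
  set k₂ : ℝ → ℝ := fun y => k₁ y + 1 * h y with hk₂
  have hk₂c : Continuous k₂ := by fun_prop
  set F₂ : ℝ → ℝ := fun x => α + s * (x - 0) + prim 0 (prim 0 k₂) x with hF₂
  have hF₂C2 : IsC2 F₂ _ k₂ := isC2_prim 0 α s hk₂c
  have hF₂c : Continuous F₂ := continuous_iff_continuousAt.2 fun x => (hF₂C2.deriv₁ x).continuousAt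
  have hF₂F₁ : ∀ x, F₂ x - F₁ x = prim 0 (prim 0 h) x := fun x => by
    simp only [hF₂, hF₁, hk₂, prim_prim_add_mul hk₁c hhc]
    ring
  have hk₂a : k₂ a = 0 := by
    simp only [hk₂, hk₁, hh, hℓ, hka]
    field_simp
    ring
  have hk₂b : k₂ b = 0 := by
    simp only [hk₂, hk₁, hh, hℓ, hkb]
    field_simp
    ring
  obtain ⟨hF, hA⟩ := hF₂C2.mem_stoppedBM (ha.trans hb)
    (f := ⟨fun x => F₂ x, hF₂c.comp continuous_subtype_val⟩) (fun x => rfl) hk₂a hk₂b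
  refine ⟨⟨_, hF⟩, fun x => ?_, fun x => ?_⟩
  · change |F₂ x - _| ≤ _
    have e : F₂ x - (α + s * x + (prim 0 (prim 0 k) x + 2 * α * prim 0 (prim 0 q) x)) =
        F₂ x - F₁ x := by
      simp only [hF₁, hk₁, prim_prim_add_mul hk hqc]
      ring
    rw [e, hF₂F₁]
    refine (hhx x x.2).trans ?_
    rw [mul_comm]
    exact mul_le_mul_of_nonneg_right (hxab x x.2) hρ0
  · have e1 : killedBM (ha.trans hb) q ⟨_, hF⟩ x = 1 / 2 * k₂ x - q x * F₂ x := by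
      rw [← hA x]
      rfl
    -- The term `q (F₁ - α)` cancels; what remains of the killing acts only on the second correction
    -- `∬ h`.
    have e2 : 1 / 2 * k₂ x - q x * F₂ x - 1 / 2 * k x =
        -(q x * prim 0 (prim 0 h) x) + 1 / 2 * ℓ x := by
      rw [← hF₂F₁]
      simp only [hk₂, hk₁, hh]
      ring
    rw [e1, e2]
    refine (abs_add_le _ _).trans (add_le_add ?_ ?_)
    · rw [abs_neg, abs_mul, abs_of_nonneg (hq x)]
      have h1 := mul_le_mul_of_nonneg_left (hhx x x.2) (hq x)
      have h2 := mul_le_mul_of_nonneg_right (hC x x.2) hρ0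
      linarith
    · rw [abs_mul, abs_of_pos (by norm_num : (0 : ℝ) < 1 / 2)]
      have := hℓL x x.2
      linarith

end Approximation

/-! ### The rescaled rates as `ε → 0`. -/

section Scaling

open MeasureTheory

theorem scaledRate_nonneg {c : C(ℝ, ℝ)} (hc : ∀ x, 0 ≤ c x) {ε : ℝ} (hε : 0 < ε) (x : ℝ) :
    0 ≤ scaledRate c ε x :=
  mul_nonneg (inv_nonneg.2 hε.le) (hc _)

theorem prim_scaledRate (c : C(ℝ, ℝ)) (ε x : ℝ) :
    prim 0 (scaledRate c ε) x = prim 0 c (ε⁻¹ * x) := by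
  have h := intervalIntegral.mul_integral_comp_mul_left (a := 0) (b := x) (f := c) ε⁻¹
  rw [mul_zero] at h
  rw [prim, prim, ← h, ← intervalIntegral.integral_const_mul]
  rfl

theorem abs_prim_le_integral {c : C(ℝ, ℝ)} (hc : ∀ x, 0 ≤ c x) (hint : Integrable c) (x : ℝ) :
    |prim 0 c x| ≤ ∫ y, c y := by
  rw [← Real.norm_eq_abs]
  refine (intervalIntegral.norm_integral_le_integral_norm_uIoc).trans ?_
  have e : ∀ y, ‖c y‖ = c y := fun y => Real.norm_of_nonneg (hc y)
  simp only [e]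
  exact setIntegral_le_integral hint (Eventually.of_forall hc)

/-- At `x = ±1` and `ε = 1 / y` the hypothesis says that `y c(±y) → 0` as `y → ∞`; compactness
handles the rest of the line. -/
theorem exists_abs_mul_le {c : C(ℝ, ℝ)}
    (hlim : ∀ x : ℝ, x ≠ 0 → Tendsto (fun ε : ℝ => ε⁻¹ * c (ε⁻¹ * x)) (𝓝[>] 0) (𝓝 0)) :
    ∃ C, ∀ y, |y| * c y ≤ C := by
  have h1 : Tendsto (fun y : ℝ => y * c y) atTop (𝓝 0) := by
    have := (hlim 1 one_ne_zero).comp tendsto_inv_atTop_nhdsGT_zero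
    simpa [Function.comp_def] using this
  have h2 : Tendsto (fun y : ℝ => y * c (-y)) atTop (𝓝 0) := by
    have := (hlim (-1) (by norm_num)).comp tendsto_inv_atTop_nhdsGT_zero
    simpa [Function.comp_def] using this
  obtain ⟨r, hr⟩ := eventually_atTop.1 ((h1.eventually_lt_const one_pos).and
    (h2.eventually_lt_const one_pos))
  obtain ⟨B, hB⟩ := (isCompact_Icc (a := -r) (b := r)).bddAbove_image
    (f := fun y => |y| * c y) (by fun_prop)
  refine ⟨max B 1, fun y => ?_⟩
  by_cases hy : |y| ≤ r
  · exact (hB ⟨y, abs_le.1 hy, rfl⟩).trans (le_max_left _ _)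
  · refine le_trans ?_ (le_max_right _ _)
    have h3 := hr |y| (not_le.1 hy).le
    rcases abs_choice y with h | h
    · rw [h] at h3 ⊢
      exact h3.1.le
    · rw [h, neg_neg] at h3
      rw [h]
      exact h3.2.le

theorem abs_mul_scaledRate_le {c : C(ℝ, ℝ)} {C : ℝ} (hC : ∀ y, |y| * c y ≤ C) {ε : ℝ} (hε : 0 < ε)
    (y : ℝ) : |y| * scaledRate c ε y ≤ C := by
  have h := hC (ε⁻¹ * y)
  rw [abs_mul, abs_of_pos (inv_pos.2 hε)] at h
  change |y| * (ε⁻¹ * c (ε⁻¹ * y)) ≤ C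
  linarith

/-- The quantity `|y| c(y)` is scale invariant, so its bound `C` dominates for every `ε > 0`, while
the integrand tends to `0` pointwise, at `y = 0` because of the factor `|y|`. -/
theorem tendsto_integral_abs_mul_scaledRate {c : C(ℝ, ℝ)} (hc : ∀ x, 0 ≤ c x)
    (hlim : ∀ x : ℝ, x ≠ 0 → Tendsto (fun ε : ℝ => ε⁻¹ * c (ε⁻¹ * x)) (𝓝[>] 0) (𝓝 0)) (a b : ℝ) :
    Tendsto (fun ε => ∫ y in a..b, |y| * scaledRate c ε y) (𝓝[>] 0) (𝓝 0) := by
  obtain ⟨C, hC⟩ := exists_abs_mul_le hlim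
  suffices h : Tendsto (fun ε => ∫ y in a..b, |y| * scaledRate c ε y) (𝓝[>] 0)
      (𝓝 (∫ _ in a..b, (0 : ℝ))) by
    rwa [intervalIntegral.integral_zero] at h
  refine intervalIntegral.tendsto_integral_filter_of_dominated_convergence (fun _ => C)
    (Eventually.of_forall fun ε => Continuous.aestronglyMeasurable (by fun_prop)) ?_
    intervalIntegrable_const ?_
  · filter_upwards [self_mem_nhdsWithin] with ε hε
    refine Eventually.of_forall fun y _ => ?_
    rw [Real.norm_of_nonneg (mul_nonneg (abs_nonneg _) (scaledRate_nonneg hc hε y))]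
    exact abs_mul_scaledRate_le hC hε y
  · refine Eventually.of_forall fun y _ => ?_
    rcases eq_or_ne y 0 with rfl | hy
    · simp
    · have := (hlim y hy).const_mul |y|
      rw [mul_zero] at this
      exact this

/-- If `Γ` has the limit `g` at infinity then the primitives of `x ↦ Γ (x / ε)` are asymptotically
linear on a bounded interval. -/
theorem exists_prim_scaled_bound {Γ : ℝ → ℝ} (hΓ : Continuous Γ) {B : ℝ} (hB : ∀ x, |Γ x| ≤ B)
    {g : ℝ} {l : Filter ℝ} {b : ℝ} (hl : ∀ y ∈ uIoc 0 b, y ≠ 0 → Tendsto (fun ε : ℝ => ε⁻¹ * y) (𝓝[>] 0) l)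
    (hg : Tendsto Γ l (𝓝 g)) :
    ∃ D : ℝ → ℝ, Tendsto D (𝓝[>] 0) (𝓝 0) ∧
      ∀ ε, ∀ x ∈ uIcc 0 b, |prim 0 (fun y => Γ (ε⁻¹ * y)) x - g * x| ≤ D ε := by
  -- The outer absolute value allows `b < 0`, so that one statement covers both sides of `0`.
  refine ⟨fun ε => abs (∫ y in (0 : ℝ)..b, |Γ (ε⁻¹ * y) - g|), ?_, fun ε x hx => ?_⟩
  · suffices h : Tendsto (fun ε => abs (∫ y in (0 : ℝ)..b, |Γ (ε⁻¹ * y) - g|)) (𝓝[>] 0)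
        (𝓝 (abs (∫ _ in (0 : ℝ)..b, (0 : ℝ)))) by
      rwa [intervalIntegral.integral_zero, abs_zero] at h
    refine (intervalIntegral.tendsto_integral_filter_of_dominated_convergence (fun _ => B + |g|)
      (Eventually.of_forall fun ε => Continuous.aestronglyMeasurable (by fun_prop))
      (Eventually.of_forall fun ε => Eventually.of_forall fun y _ => ?_)
      intervalIntegrable_const ?_).abs
    · rw [Real.norm_eq_abs, abs_abs]
      exact (abs_sub _ _).trans (by gcongr; exact hB _)
    · have hne : ∀ᵐ y : ℝ, y ≠ 0 := compl_mem_ae_iff.2 (measure_singleton 0)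
      filter_upwards [hne] with y hy0 hy
      have := ((hg.comp (hl y hy hy0)).sub_const g).abs
      rwa [sub_self, abs_zero] at this
  · have e : prim 0 (fun y => Γ (ε⁻¹ * y)) x - g * x =
        ∫ y in (0 : ℝ)..x, (Γ (ε⁻¹ * y) - g) := by
      rw [intervalIntegral.integral_sub (Continuous.intervalIntegrable (by fun_prop) _ _)
        intervalIntegrable_const, intervalIntegral.integral_const, smul_eq_mul, prim]
      ring
    rw [e]
    refine (intervalIntegral.norm_integral_le_abs_integral_norm
      (f := fun y => Γ (ε⁻¹ * y) - g)).trans ?_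
    refine intervalIntegral.abs_integral_mono_interval (f := fun y => |Γ (ε⁻¹ * y) - g|) ?_ (Eventually.of_forall fun y => abs_nonneg _)
      (Continuous.intervalIntegrable (by fun_prop) _ _)
    rw [uIoc, uIoc]
    rw [uIcc, mem_Icc] at hx
    exact Ioc_subset_Ioc (le_min (min_le_left _ _) hx.1) (max_le (le_max_left _ _) hx.2)

theorem tendsto_inv_mul_atTop_nhdsGT {y : ℝ} (hy : 0 < y) :
    Tendsto (fun ε : ℝ => ε⁻¹ * y) (𝓝[>] 0) atTop :=
  tendsto_inv_nhdsGT_zero.atTop_mul_const hy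

theorem tendsto_inv_mul_atBot_nhdsGT {y : ℝ} (hy : y < 0) :
    Tendsto (fun ε : ℝ => ε⁻¹ * y) (𝓝[>] 0) atBot :=
  tendsto_inv_nhdsGT_zero.atTop_mul_const_of_neg hy

/-- The twice integrated rates converge uniformly to a piecewise linear function with a kink of
size `γ` at `0`. -/
theorem exists_prim_prim_scaledRate_bound {a b : ℝ} (ha : a < 0) (hb : 0 < b) {c : C(ℝ, ℝ)}
    (hc : ∀ x, 0 ≤ c x) (hint : Integrable c) :
    ∃ (g : ℝ) (D : ℝ → ℝ), Tendsto D (𝓝[>] 0) (𝓝 0) ∧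
      (∀ ε, ∀ x ∈ Icc a 0, |prim 0 (prim 0 (scaledRate c ε)) x + g * x| ≤ D ε) ∧
      ∀ ε, ∀ x ∈ Icc 0 b, |prim 0 (prim 0 (scaledRate c ε)) x - ((∫ y, c y) - g) * x| ≤ D ε := by
  have hB := abs_prim_le_integral hc hint
  have hcont : Continuous (prim 0 c) := continuous_prim 0 c.continuous
  have e : ∀ ε, prim 0 (scaledRate c ε) = fun y => prim 0 c (ε⁻¹ * y) := fun ε =>
    funext (prim_scaledRate c ε)
  have hR : Tendsto (prim 0 c) atTop (𝓝 (∫ y in Ioi 0, c y)) :=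
    intervalIntegral_tendsto_integral_Ioi 0 hint.integrableOn tendsto_id
  have hL : Tendsto (prim 0 c) atBot (𝓝 (-∫ y in Iic 0, c y)) := by
    refine (intervalIntegral_tendsto_integral_Iic 0 hint.integrableOn tendsto_id).neg.congr
      fun x => ?_
    rw [← intervalIntegral.integral_symm]
    rfl
  obtain ⟨D₁, h1, h1'⟩ := exists_prim_scaled_bound hcont hB (b := a) (fun y hy hy0 =>
    tendsto_inv_mul_atBot_nhdsGT (by
      rw [uIoc_of_ge ha.le] at hy
      exact lt_of_le_of_ne hy.2 hy0)) hL
  obtain ⟨D₂, h2, h2'⟩ := exists_prim_scaled_bound hcont hB (b := b) (fun y hy _ =>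
    tendsto_inv_mul_atTop_nhdsGT (by rw [uIoc_of_le hb.le] at hy; exact hy.1)) hR
  have hsum : (∫ y in Ioi 0, c y) = (∫ y, c y) - ∫ y in Iic 0, c y := by
    rw [eq_sub_iff_add_eq', intervalIntegral.integral_Iic_add_Ioi hint.integrableOn
      hint.integrableOn]
  refine ⟨∫ y in Iic 0, c y, fun ε => |D₁ ε| + |D₂ ε|, by simpa using h1.abs.add h2.abs,
    fun ε x hx => ?_, fun ε x hx => ?_⟩
  · have := h1' ε x (by rwa [uIcc_of_ge ha.le])
    rw [neg_mul, sub_neg_eq_add] at this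
    rw [e]
    exact this.trans ((le_abs_self _).trans (le_add_of_nonneg_right (abs_nonneg _)))
  · have := h2' ε x (by rwa [uIcc_of_le hb.le])
    rw [hsum] at this
    rw [e]
    exact this.trans ((le_abs_self _).trans (le_add_of_nonneg_left (abs_nonneg _)))

end Scaling

/-! ### Graph convergence and the main theorem. -/

theorem ContinuousMap.tendsto_of_forall_abs_sub_le {K ι : Type*} [TopologicalSpace K]
    [CompactSpace K] {l : Filter ι} {F : ι → C(K, ℝ)} {f : C(K, ℝ)} {D : ι → ℝ}
    (hD : Tendsto D l (𝓝 0)) (h : ∀ᶠ i in l, ∀ x, |F i x - f x| ≤ D i) : Tendsto F l (𝓝 f) := by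
  rw [tendsto_iff_norm_sub_tendsto_zero]
  have hD' : Tendsto (fun i => |D i|) l (𝓝 0) := by simpa using hD.abs
  refine squeeze_zero' (Eventually.of_forall fun _ => norm_nonneg _) (h.mono fun i hi => ?_) hD'
  exact (ContinuousMap.norm_le _ (abs_nonneg _)).2 fun x => (hi x).trans (le_abs_self _)

/-- The generators `killedBM (scaledRate c ε)` converge in the sense of graphs to the generator
`elasticBM (2 γ)`. -/
theorem exists_tendsto_killedBM {a b : ℝ} (ha : a < 0) (hb : 0 < b) {c : C(ℝ, ℝ)}
    (hc : ∀ x, 0 ≤ c x) (hint : MeasureTheory.Integrable c) {γ : ℝ} (hγ : ∫ x, c x = γ)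
    (hlim : ∀ x : ℝ, x ≠ 0 → Tendsto (fun ε : ℝ => ε⁻¹ * c (ε⁻¹ * x)) (𝓝[>] 0) (𝓝 0))
    (f : (elasticBM ha hb (2 * γ)).domain) :
    ∃ F G : ℝ → C(Icc a b, ℝ),
      (∀ᶠ ε in 𝓝[>] 0, ∃ hF : F ε ∈ (killedBM (ha.trans hb) (scaledRate c ε)).domain,
        killedBM (ha.trans hb) (scaledRate c ε) ⟨F ε, hF⟩ = G ε) ∧
      Tendsto F (𝓝[>] 0) (𝓝 (f : C(Icc a b, ℝ))) ∧
      Tendsto G (𝓝[>] 0) (𝓝 (elasticBM ha hb (2 * γ) f)) := by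
  obtain ⟨α, p, k, hk, hka, hkb, hA, hl, hr⟩ := elasticBM_eq_taylor ha hb f
  obtain ⟨g, D, hD, hDl, hDr⟩ := exists_prim_prim_scaledRate_bound ha hb hc hint
  rw [hγ] at hDr
  obtain ⟨C, hC⟩ := exists_abs_mul_le hlim
  -- On the left `2 α ∬ c_ε` tends to `-2 α g x`; this choice of `s` restores the slope `p` there
  -- and yields `p + 2 γ α` on the right.
  let s : ℝ := p + 2 * α * g
  let M : ℝ := |s| + (∫ y in a..b, |k y|) + 2 * |α| * γ
  let N : ℝ := |α| + M * (b - a)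
  let m : ℝ → ℝ := fun ε => ∫ y in a..b, |y| * scaledRate c ε y
  let δ : ℝ → ℝ := fun ε => scaledRate c ε a + scaledRate c ε b
  let ρ : ℝ → ℝ := fun ε => 2 * M * m ε + (b - a) * (2 * δ ε * N)
  have hm : Tendsto m (𝓝[>] 0) (𝓝 0) := tendsto_integral_abs_mul_scaledRate hc hlim a b
  have hδ : Tendsto δ (𝓝[>] 0) (𝓝 0) := by
    have := (hlim a ha.ne).add (hlim b hb.ne')
    rw [add_zero] at this
    exact this
  have hρ : Tendsto ρ (𝓝[>] 0) (𝓝 0) := by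
    have := (hm.const_mul (2 * M)).add (((hδ.const_mul 2).mul_const N).const_mul (b - a))
    simpa using this
  have key : ∀ ε : ℝ, 0 < ε → _ := fun ε hε =>
    exists_mem_killedBM_close ha hb (q := scaledRate c ε) (scaledRate_nonneg hc hε) (γ := γ)
      (C := C) (fun y _ => by rw [prim_scaledRate, ← hγ]; exact abs_prim_le_integral hc hint _)
      (fun y _ => abs_mul_scaledRate_le hC hε y) α s hk hka hkb (M := M) rfl (N := N) rfl
      (ρ := ρ ε) rfl
  -- The rate is known to be nonnegative only for `ε > 0`; other `ε` receive the value `0`.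
  have key' : ∀ ε : ℝ, ∃ F G : C(Icc a b, ℝ), 0 < ε →
      (∃ hF : F ∈ (killedBM (ha.trans hb) (scaledRate c ε)).domain,
        killedBM (ha.trans hb) (scaledRate c ε) ⟨F, hF⟩ = G) ∧
      (∀ x : Icc a b, |F x - (α + s * x + (prim 0 (prim 0 k) x +
        2 * α * prim 0 (prim 0 (scaledRate c ε)) x))| ≤ (b - a) * ρ ε) ∧
      ∀ x : Icc a b, |G x - 1 / 2 * k x| ≤ C * ρ ε + δ ε * N := by
    intro ε
    by_cases hε : 0 < ε
    · obtain ⟨F, h1, h2⟩ := key ε hε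
      exact ⟨F, _, fun _ => ⟨⟨F.2, rfl⟩, h1, h2⟩⟩
    · exact ⟨0, 0, fun h => absurd h hε⟩
  choose F G hFG using key'
  refine ⟨F, G, ?_, ?_, ?_⟩
  · filter_upwards [self_mem_nhdsWithin] with ε hε
    exact (hFG ε hε).1
  · refine ContinuousMap.tendsto_of_forall_abs_sub_le
      (D := fun ε => (b - a) * ρ ε + 2 * |α| * D ε) ?_ ?_
    · simpa using (hρ.const_mul (b - a)).add (hD.const_mul (2 * |α|))
    filter_upwards [self_mem_nhdsWithin] with ε hε x
    have h1 := (hFG ε hε).2.1 x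
    have h2 : |α + s * x + (prim 0 (prim 0 k) x +
        2 * α * prim 0 (prim 0 (scaledRate c ε)) x) - f.1 x| ≤ 2 * |α| * D ε := by
      rcases le_total (x : ℝ) 0 with hx | hx
      · have e : α + s * x + (prim 0 (prim 0 k) x +
            2 * α * prim 0 (prim 0 (scaledRate c ε)) x) - f.1 x =
            2 * α * (prim 0 (prim 0 (scaledRate c ε)) x + g * x) := by
          rw [hl x hx]
          ring
        rw [e, abs_mul, abs_mul, abs_two]
        gcongr
        exact hDl ε x ⟨x.2.1, hx⟩
      · have e : α + s * x + (prim 0 (prim 0 k) x +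
            2 * α * prim 0 (prim 0 (scaledRate c ε)) x) - f.1 x =
            2 * α * (prim 0 (prim 0 (scaledRate c ε)) x - (γ - g) * x) := by
          rw [hr x hx]
          ring
        rw [e, abs_mul, abs_mul, abs_two]
        gcongr
        exact hDr ε x ⟨hx, x.2.2⟩
    exact (abs_sub_le _ _ _).trans (add_le_add h1 h2)
  · refine ContinuousMap.tendsto_of_forall_abs_sub_le (D := fun ε => C * ρ ε + δ ε * N) ?_ ?_
    · simpa using (hρ.const_mul C).add (hδ.mul_const N)
    filter_upwards [self_mem_nhdsWithin] with ε hε x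
    rw [hA]
    exact (hFG ε hε).2.2 x

/-- For a continuous `c ≥ 0` on the line with integral `γ` such that `c_ε(x) = ε⁻¹ c(ε⁻¹ x) → 0` for
`x ≠ 0`, the operator `A` is a Feller generator, so are the `A_ε`, and the semigroups `S ε`
generated by `A_ε` converge strongly, uniformly on bounded time intervals, to the semigroup `T`
generated by `A`. -/
theorem theorem1 {a b : ℝ} (ha : a < 0) (hb : 0 < b) (c : C(ℝ, ℝ)) (hc : ∀ x, 0 ≤ c x)
    (hint : MeasureTheory.Integrable c) (γ : ℝ) (hγ : ∫ x, c x = γ)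
    (hlim : ∀ x : ℝ, x ≠ 0 → Tendsto (fun ε : ℝ => ε⁻¹ * c (ε⁻¹ * x)) (𝓝[>] 0) (𝓝 0)) :
    IsFellerGenerator (elasticBM ha hb (2 * γ)) ∧
    (∀ ε ∈ Ioc (0 : ℝ) 1, IsFellerGenerator (killedBM (ha.trans hb) (scaledRate c ε))) ∧
    ∀ (T : ℝ≥0 → C(Icc a b, ℝ) →L[ℝ] C(Icc a b, ℝ))
      (S : ℝ → ℝ≥0 → C(Icc a b, ℝ) →L[ℝ] C(Icc a b, ℝ)),
      IsFellerSemigroup T → IsGeneratorOf (elasticBM ha hb (2 * γ)) T →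
      (∀ ε ∈ Ioc (0 : ℝ) 1, IsFellerSemigroup (S ε) ∧
        IsGeneratorOf (killedBM (ha.trans hb) (scaledRate c ε)) (S ε)) →
      ∀ (f : C(Icc a b, ℝ)) (t₀ : ℝ≥0),
        TendstoUniformlyOn (fun ε t => S ε t f) (fun t => T t f) (𝓝[>] 0) (Iic t₀) := by
  have hκ : 0 ≤ 2 * γ := hγ ▸ mul_nonneg two_pos.le (MeasureTheory.integral_nonneg hc)
  refine ⟨isFellerGenerator_elasticBM ha hb hκ, fun ε hε =>
    isFellerGenerator_killedBM ha hb (scaledRate_nonneg hc hε.1), ?_⟩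
  intro T S hT hAT hS f t₀
  -- Nothing is assumed about `S ε` outside `(0, 1]`, hence the eventual hypotheses in the
  -- Trotter–Kato theorem.
  have hev : ∀ᶠ ε : ℝ in 𝓝[>] 0, ε ∈ Ioc (0 : ℝ) 1 := Ioc_mem_nhdsGT one_pos
  exact tendstoUniformlyOn_semigroup (isMDissipative_elasticBM ha hb hκ) (dense_elasticBM ha hb _)
    hT.isContractionSemigroup hAT
    (hev.mono fun ε hε => isMDissipative_killedBM ha hb (scaledRate_nonneg hc hε.1))
    (hev.mono fun ε hε => (hS ε hε).1.isContractionSemigroup)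
    (hev.mono fun ε hε => (hS ε hε).2)
    (exists_tendsto_killedBM ha hb hc hint hγ hlim) f t₀
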